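/- Let $n\ge 2$. Let $\mathrm{Br}_n$ be the braid group on $n$ strands with its standard generators $\sigma_1,\dots,\sigma_{n-1}$ and relations $\sigma_i\sigma_{i+1}\sigma_i=\sigma_{i+1}\sigma_i\sigma_{i+1}$ and $\sigma_i\sigma_j=\sigma_j\sigma_i$ for $|i-j|\ge 2$. For any group $G$, $\mathrm{Br}_n$ acts on the left on $G^n$ by the Hurwitz action $$\sigma_i(g_1,\dots,g_n)=(g_1,\dots,g_{i-1},\,g_ig_{i+1}g_i^{-1},\,g_i,\,g_{i+2},\dots,g_n).$$ Let $M_n=(m_{ij})_{1\le i,j\le n}$ with $m_{ij}=1$ if $i\equiv j \pmod 2$ and $m_{ij}=3$ otherwise. Let $$A_{M_n}=\langle a_1,\dots,a_n\mid \underbrace{a_ia_ja_i\cdots}_{m_{ij}}=\underbrace{a_ja_ia_j\cdots}_{m_{ij}}\rangle,\qquad C_{M_n}=\langle s_1,\dots,s_n\mid s_i^2=(s_is_j)^{m_{ij}}=1\rangle$$ be the Artin group and the Coxeter group of $M_n$, and let $S_{\mathcal A_n}$ and $S_{\mathcal C_n}$ be the stabilisers in $\mathrm{Br}_n$ of the Artin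 system $(a_1,\dots,a_n)\in A_{M_n}^n$ and of the Coxeter system $(s_1,\dots,s_n)\in C_{M_n}^n$. Let $$E_n=\left\langle e_{ij}=\sigma_{j-1}\cdots\sigma_{i+1}\,\sigma_i^{m_{ij}}\,\sigma_{i+1}^{-1}\cdots\sigma_{j-1}^{-1}\;:\;1\le i<j\le n\right\rangle\le\mathrm{Br}_n .$$ Then $S_{\mathcal A_n}$ is also the stabiliser of the alternating Artin system $(a,b,a,b,\dots)\in \mathrm{Br}_3^n$, where $\mathrm{Br}_3=\langle a,b\mid aba=bab\rangle$, and $S_{\mathcal C_n}$ is also the stabiliser of the alternating Coxeter system $(s,t,s,t,\dots)\in \mathcal S_3^n$, where $s=(1\,2)$ and $t=(2\,3)$ in the symmetric group $\mathcal S_3$. Moreover: 1. if $n\in\{2,3,4\}$, then $E_n=S_{\mathcal A_n}=S_{\mathcal C_n}$; 2. if $n\in\{5,6\}$, then $E_n=S_{\mathcal A_n}\subsetneq S_{\mathcal C_n}$; 3. if $n\ge 7$, then $E_n\le S_{\mathcal A_n}\subsetneq S_{\mathcal C_n}$. -/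

import Mathlib

/-- The braid group on `n` strands, by Artin's presentation. The generators are indexed from `0`:
the index `i : Fin (n - 1)` stands for the standard generator crossing the strands in positions
`i` and `i + 1`. -/
abbrev BraidGroup (n : ℕ) : Type :=
  PresentedGroup
    ({r : FreeGroup (Fin (n - 1)) | ∃ i j : Fin (n - 1), (i : ℕ) + 1 = j ∧
        r = FreeGroup.of i * FreeGroup.of j * FreeGroup.of i *
          (FreeGroup.of j * FreeGroup.of i * FreeGroup.of j)⁻¹} ∪
     {r : FreeGroup (Fin (n - 1)) | ∃ i j : Fin (n - 1), (i : ℕ) + 2 ≤ j ∧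
        r = FreeGroup.of i * FreeGroup.of j * (FreeGroup.of j * FreeGroup.of i)⁻¹})

/-- The standard generator `σ k` of the braid group on `n` strands, `0 ≤ k < n - 1`
(and `1` for larger `k`, a value that is never used). -/
def sigma (n k : ℕ) : BraidGroup n :=
  if h : k < n - 1 then PresentedGroup.of ⟨k, h⟩ else 1

/-- The elementary Hurwitz move
`(…, g i, g (i + 1), …) ↦ (…, g i * g (i + 1) * (g i)⁻¹, g i, …)`. -/
def hurwitzMove {n : ℕ} {G : Type*} [Group G] (i : Fin (n - 1)) : Equiv.Perm (Fin n → G) where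
  toFun g k :=
    if (k : ℕ) = i then
      g ⟨i, by omega⟩ * g ⟨i + 1, by omega⟩ * (g ⟨i, by omega⟩)⁻¹
    else if (k : ℕ) = i + 1 then g ⟨i, by omega⟩
    else g k
  invFun g k :=
    if (k : ℕ) = i then g ⟨i + 1, by omega⟩
    else if (k : ℕ) = i + 1 then
      (g ⟨i + 1, by omega⟩)⁻¹ * g ⟨i, by omega⟩ * g ⟨i + 1, by omega⟩
    else g k
  left_inv g := by
    funext ⟨k, hk⟩
    by_cases h : k = i
    · subst h; simp
    · by_cases h' : k = i + 1
      · subst h'; simp [mul_assoc]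
      · simp [h, h']
  right_inv g := by
    funext ⟨k, hk⟩
    by_cases h : k = i
    · subst h; simp [mul_assoc]
    · by_cases h' : k = i + 1
      · subst h'; simp
      · simp [h, h']

theorem hurwitzMove_braid {n : ℕ} {G : Type*} [Group G] (i j : Fin (n - 1))
    (h : (i : ℕ) + 1 = j) :
    (hurwitzMove i * hurwitzMove j * hurwitzMove i : Equiv.Perm (Fin n → G)) =
      hurwitzMove j * hurwitzMove i * hurwitzMove j := by
  obtain ⟨i, hi⟩ := i
  obtain ⟨j, hj⟩ := j
  simp only at h
  subst h
  have e1 : ∀ m : ℕ, m ≠ m + 1 + 1 := by omega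
  have e2 : ∀ m : ℕ, m + 1 + 1 ≠ m := by omega
  ext g ⟨k, hk⟩
  simp only [Equiv.Perm.mul_apply, hurwitzMove, Equiv.coe_fn_mk]
  by_cases h0 : k = i
  · subst h0; simp [mul_assoc, e1, e2]
  · by_cases h1 : k = i + 1
    · subst h1; simp [mul_assoc, e1, e2]
    · by_cases h2 : k = i + 1 + 1
      · subst h2; simp [e1, e2]
      · simp [h0, h1, h2]

theorem hurwitzMove_comm {n : ℕ} {G : Type*} [Group G] (i j : Fin (n - 1))
    (h : (i : ℕ) + 2 ≤ j) :
    (hurwitzMove i * hurwitzMove j : Equiv.Perm (Fin n → G)) =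
      hurwitzMove j * hurwitzMove i := by
  obtain ⟨i, hi⟩ := i
  obtain ⟨j, hj⟩ := j
  simp only at h
  have e1 : i ≠ j := by omega
  have e2 : i ≠ j + 1 := by omega
  have e3 : i + 1 ≠ j := by omega
  have e4 : i + 1 ≠ j + 1 := by omega
  ext g ⟨k, hk⟩
  simp only [Equiv.Perm.mul_apply, hurwitzMove, Equiv.coe_fn_mk]
  by_cases h0 : k = i
  · subst h0; simp [e1, e2, e3]
  · by_cases h1 : k = i + 1
    · subst h1; simp [e1, e2, e3]
    · by_cases h2 : k = j
      · subst h2; simp [e1.symm, e2.symm, e3.symm]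
      · by_cases h3 : k = j + 1
        · subst h3; simp [e1.symm, e2.symm, e3.symm]
        · simp [h0, h1, h2, h3]

/-- The Hurwitz action (a left action) of the braid group on `n` strands on `n`-tuples in `G`. -/
def hurwitzAction (n : ℕ) (G : Type*) [Group G] : BraidGroup n →* Equiv.Perm (Fin n → G) :=
  PresentedGroup.toGroup (f := fun i => hurwitzMove i) (by
    rintro r (⟨i, j, h, rfl⟩ | ⟨i, j, h, rfl⟩)
    · simp only [map_mul, map_inv, FreeGroup.lift_apply_of, mul_inv_eq_one]
      exact hurwitzMove_braid i j h
    · simp only [map_mul, map_inv, FreeGroup.lift_apply_of, mul_inv_eq_one]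
      exact hurwitzMove_comm i j h)

/-- The Hurwitz stabiliser in the braid group of an `n`-tuple in `G`. -/
def hurwitzStabilizer {n : ℕ} {G : Type*} [Group G] (g : Fin n → G) : Subgroup (BraidGroup n) :=
  (MulAction.stabilizer (Equiv.Perm (Fin n → G)) g).comap (hurwitzAction n G)

/-- The Coxeter group of a symmetric matrix `M` of positive integers, by generators and relations.
Off-diagonal entries `1` are allowed; they make two generators equal. -/
abbrev CoxeterGroupOf {n : ℕ} (M : Matrix (Fin n) (Fin n) ℕ) : Type :=
  PresentedGroup
    ({r : FreeGroup (Fin n) | ∃ i, r = FreeGroup.of i ^ 2} ∪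
     {r : FreeGroup (Fin n) | ∃ i j, r = (FreeGroup.of i * FreeGroup.of j) ^ M i j})

/-- The Coxeter system of `M`: the tuple of the standard generators. -/
def coxeterSystem {n : ℕ} (M : Matrix (Fin n) (Fin n) ℕ) : Fin n → CoxeterGroupOf M :=
  fun i => PresentedGroup.of i

/-- The alternating product `x * y * x * ⋯` with `m` factors. -/
def altProd {G : Type*} [Group G] : ℕ → G → G → G
  | 0, _, _ => 1
  | m + 1, x, y => x * altProd m y x

/-- The Artin group of a symmetric matrix `M` of positive integers, by generators and relations.
Off-diagonal entries `1` are allowed; they make two generators equal. -/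
abbrev ArtinGroupOf {n : ℕ} (M : Matrix (Fin n) (Fin n) ℕ) : Type :=
  PresentedGroup
    {r : FreeGroup (Fin n) | ∃ i j,
      r = altProd (M i j) (FreeGroup.of i) (FreeGroup.of j) *
        (altProd (M i j) (FreeGroup.of j) (FreeGroup.of i))⁻¹}

/-- The Artin system of `M`: the tuple of the standard generators. -/
def artinSystem {n : ℕ} (M : Matrix (Fin n) (Fin n) ℕ) : Fin n → ArtinGroupOf M :=
  fun i => PresentedGroup.of i

/-- The matrix with entry `1` where `i ≡ j` modulo `2` and `3` elsewhere. -/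
def altMatrix (n : ℕ) : Matrix (Fin n) (Fin n) ℕ :=
  fun i j => if (i : ℕ) ≡ j [MOD 2] then 1 else 3

/-- The alternating `n`-tuple `(x, y, x, y, …)`. -/
def alternating {G : Type*} (n : ℕ) (x y : G) : Fin n → G :=
  fun i => if Even (i : ℕ) then x else y

/-- The alternating Artin system `(a, b, a, b, …)`, where `a`, `b` are the standard generators of
the braid group on three strands. -/
def altArtin (n : ℕ) : Fin n → BraidGroup 3 :=
  alternating n (sigma 3 0) (sigma 3 1)

/-- The alternating Coxeter system `(s, t, s, t, …)` in the symmetric group on three elements. -/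
def altCoxeter (n : ℕ) : Fin n → Equiv.Perm (Fin 3) :=
  alternating n (Equiv.swap 0 1) (Equiv.swap 1 2)

/-- The product `σ (j - 1) * ⋯ * σ (i + 1)` (equal to `1` if `j = i + 1`). -/
def descProd (n i j : ℕ) : BraidGroup n :=
  ((List.Ico (i + 1) j).reverse.map (sigma n)).prod

/-- The element `σ (j - 1) ⋯ σ (i + 1) * σ i ^ m * (σ (i + 1))⁻¹ ⋯ (σ (j - 1))⁻¹`. -/
def bandPow (n m i j : ℕ) : BraidGroup n :=
  descProd n i j * sigma n i ^ m * (descProd n i j)⁻¹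

/-- The subgroup generated by the elements `e i j`, `i < j`, attached to `M`. -/
def bandSubgroup {n : ℕ} (M : Matrix (Fin n) (Fin n) ℕ) : Subgroup (BraidGroup n) :=
  Subgroup.closure {x | ∃ i j : Fin n, i < j ∧ x = bandPow n (M i j) i j}

/-!
The inclusions that hold for every `n` are formal. The Hurwitz action is natural in the group
(`hurwitzAction_comp`), so a homomorphism that takes one tuple to another gives an inclusion of
stabilisers; applied in both directions this identifies the stabilisers of the Artin system and of
`altArtin`, and the group of the Coxeter system embeds in the symmetric group. A generator of the
band subgroup first brings the `i`-th and the `j`-th entry side by side without changing either,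
and two such entries satisfy the Artin relation, so the band subgroup `E` stabilises `altArtin`.

The inclusions into `E` rest on a coset enumeration. Up to affine maps, the tuples of
transpositions in the braid group orbit of `(s, t, s, t, …)` form a set of 3, 8, 27 elements for
`n = 2, 3, 4` (where no affine map is needed) and of 40 elements for `n = 5, 6`, and these sets are
nested, so that one table with 40 rows and 5 columns describes the action of all generators. Let
`H` be `E` for `n ≤ 4`, the subgroup generated by `E` and the full twist for `n = 5`, and the
subgroup generated by `E`, `orderThreeBraid` and `orderTwoBraid` for `n = 6`. Starting from a few
entries that hold because generators of `H` fix the trivial coset, the braid relations force all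
entries of the table to be valid in the set of cosets of `H`: a relation, read at a coset, with all
entries but one known yields the last one (`realised_of_completes`). Hence `H` has at most as many
cosets as there are rows (`exists_cosetRep_of_completes`), and the coset representatives are
separated by their action on transpositions.

For `n ≤ 4` this already gives the stabiliser of `altCoxeter`. For `n = 5, 6` it shows that the
stabiliser of `altArtin` is contained in `H`, and the elements of `H` act on `altArtin` by
simultaneous conjugation, with `E` acting trivially. For `n = 5` the full twist is central and acts
as conjugation by an element of infinite order modulo the centre, so only elements of `E` act
trivially; its square stabilises `altCoxeter`, which gives the strict inclusions for all `n ≥ 5`.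
For `n = 6`, the group `H` normalises `E`: the conjugates of suitable generators of `E` stabilise
the tuple and involve only five consecutive strands, so the case `n = 5` applies to them. The
quotient `H / E` is generated by an element of order three and one of order two, which act as the
corresponding elements of the modular group. As that group is their free product, the action is
faithful (`mem_bandSubgroup_of_mem_closure`); concretely, in a normal form of an element of `H` the
middle factor acts as a matrix with nonnegative entries.
-/

theorem mem_hurwitzStabilizer {n : ℕ} {G : Type*} [Group G] {g : Fin n → G} {b : BraidGroup n} :
    b ∈ hurwitzStabilizer g ↔ hurwitzAction n G b g = g := Iff.rfl

theorem sigma_of_lt {n k : ℕ} (h : k < n - 1) : sigma n k = PresentedGroup.of ⟨k, h⟩ := dif_pos h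

theorem BraidGroup.induction {n : ℕ} {p : BraidGroup n → Prop} (one : p 1)
    (sigma : ∀ k < n - 1, p (sigma n k)) (mul : ∀ a b, p a → p b → p (a * b))
    (inv : ∀ a, p a → p a⁻¹) (b : BraidGroup n) : p b := by
  have hb : b ∈ Subgroup.closure (Set.range (PresentedGroup.of :
      Fin (n - 1) → BraidGroup n)) := by
    rw [PresentedGroup.closure_range_of]; trivial
  induction hb using Subgroup.closure_induction with
  | mem x hx =>
    obtain ⟨⟨k, hk⟩, rfl⟩ := hx
    exact sigma_of_lt hk ▸ sigma k hk
  | one => exact one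
  | mul a b _ _ ha hb => exact mul a b ha hb
  | inv a _ ha => exact inv a ha

theorem sigma_braid {n k : ℕ} (h : k + 2 < n) :
    sigma n k * sigma n (k + 1) * sigma n k = sigma n (k + 1) * sigma n k * sigma n (k + 1) := by
  rw [sigma_of_lt (show k < n - 1 by omega), sigma_of_lt (show k + 1 < n - 1 by omega)]
  refine mul_inv_eq_one.mp (PresentedGroup.one_of_mem (Or.inl ⟨⟨k, by omega⟩, ⟨k + 1, by omega⟩, rfl, rfl⟩))

theorem sigma_comm {n i j : ℕ} (h : i + 2 ≤ j) : Commute (sigma n i) (sigma n j) := by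
  by_cases hj : j < n - 1
  · rw [sigma_of_lt (show i < n - 1 by omega), sigma_of_lt hj]
    exact mul_inv_eq_one.mp
      (PresentedGroup.one_of_mem (Or.inr ⟨⟨i, by omega⟩, ⟨j, by omega⟩, h, rfl⟩))
  · simp [sigma, hj]

theorem hurwitzAction_sigma {n k : ℕ} {G : Type*} [Group G] (h : k < n - 1) :
    hurwitzAction n G (sigma n k) = hurwitzMove ⟨k, h⟩ := by
  rw [sigma_of_lt h]; simp [hurwitzAction]

/-- The Hurwitz action is natural in the group. -/
theorem hurwitzAction_comp {n : ℕ} {G H : Type*} [Group G] [Group H] (f : G →* H)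
    (b : BraidGroup n) (t : Fin n → G) :
    hurwitzAction n H b (f ∘ t) = f ∘ hurwitzAction n G b t := by
  induction b using BraidGroup.induction generalizing t with
  | one => simp
  | sigma k hk =>
    rw [hurwitzAction_sigma hk, hurwitzAction_sigma hk]
    funext i
    simp only [hurwitzMove, Equiv.coe_fn_mk, Function.comp_apply]
    split_ifs <;> simp
  | mul a b ha hb => simp [hb, ha]
  | inv a ha =>
    rw [map_inv, map_inv, Equiv.Perm.inv_eq_iff_eq, ha]
    simp

theorem hurwitzStabilizer_le_comp {n : ℕ} {G H : Type*} [Group G] [Group H] (f : G →* H)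
    (t : Fin n → G) : hurwitzStabilizer t ≤ hurwitzStabilizer (f ∘ t) := fun b hb => by
  rw [mem_hurwitzStabilizer] at *
  rw [hurwitzAction_comp, hb]

theorem hurwitzStabilizer_comp_of_injective {n : ℕ} {G H : Type*} [Group G] [Group H] (f : G →* H)
    (hf : Function.Injective f) (t : Fin n → G) :
    hurwitzStabilizer (f ∘ t) = hurwitzStabilizer t := by
  refine le_antisymm (fun b hb => ?_) (hurwitzStabilizer_le_comp f t)
  rw [mem_hurwitzStabilizer] at *
  rw [hurwitzAction_comp] at hb
  exact hf.comp_left hb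

theorem comp_alternating {G H : Type*} [Group G] [Group H] (f : G →* H) (n : ℕ) (x y : G) :
    f ∘ alternating n x y = alternating n (f x) (f y) := by
  funext i; simp [alternating, apply_ite f]

/-! ### Homomorphisms from the braid group on three strands -/

/-- The homomorphism from the braid group on three strands given by two elements satisfying the
braid relation. -/
def braidThreeLift {G : Type*} [Group G] (x y : G) (h : x * y * x = y * x * y) :
    BraidGroup 3 →* G :=
  PresentedGroup.toGroup (f := fun i : Fin (3 - 1) => if (i : ℕ) = 0 then x else y) (by
    rintro r (⟨i, j, hij, rfl⟩ | ⟨i, j, hij, rfl⟩)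
    · have hi : (i : ℕ) = 0 := by omega
      have hj : (j : ℕ) ≠ 0 := by omega
      simp only [map_mul, map_inv, FreeGroup.lift_apply_of, mul_inv_eq_one, hi, hj, if_true,
        if_false, h]
    · omega)

@[simp] theorem braidThreeLift_sigma_zero {G : Type*} [Group G] (x y : G)
    (h : x * y * x = y * x * y) : braidThreeLift x y h (sigma 3 0) = x := by
  rw [sigma_of_lt (by omega)]; simp [braidThreeLift]

@[simp] theorem braidThreeLift_sigma_one {G : Type*} [Group G] (x y : G)
    (h : x * y * x = y * x * y) : braidThreeLift x y h (sigma 3 1) = y := by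
  rw [sigma_of_lt (by omega)]; simp [braidThreeLift]

theorem hurwitzStabilizer_altArtin_le {G : Type*} [Group G] (n : ℕ) (x y : G)
    (h : x * y * x = y * x * y) :
    hurwitzStabilizer (altArtin n) ≤ hurwitzStabilizer (alternating n x y) := by
  have := hurwitzStabilizer_le_comp (braidThreeLift x y h) (altArtin n)
  rwa [altArtin, comp_alternating, braidThreeLift_sigma_zero, braidThreeLift_sigma_one] at this

theorem hurwitzStabilizer_altArtin_le_altCoxeter (n : ℕ) :
    hurwitzStabilizer (altArtin n) ≤ hurwitzStabilizer (altCoxeter n) :=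
  hurwitzStabilizer_altArtin_le n _ _ (by decide)

theorem hurwitzStabilizer_alternating_swap (n : ℕ) :
    hurwitzStabilizer (alternating n (sigma 3 1) (sigma 3 0)) =
      hurwitzStabilizer (altArtin n) := by
  have hb : sigma 3 1 * sigma 3 0 * sigma 3 1 = sigma 3 0 * sigma 3 1 * sigma 3 0 :=
    (sigma_braid (n := 3) (k := 0) (by omega)).symm
  refine le_antisymm ?_ (hurwitzStabilizer_altArtin_le n _ _ hb)
  have := hurwitzStabilizer_le_comp (braidThreeLift _ _ hb) (alternating n (sigma 3 1) (sigma 3 0))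
  rwa [comp_alternating, braidThreeLift_sigma_zero, braidThreeLift_sigma_one] at this

/-! ### The Artin and the Coxeter system of the alternating matrix -/

theorem altMatrix_eq_one {n : ℕ} {i j : Fin n} (h : Even (i : ℕ) ↔ Even (j : ℕ)) :
    altMatrix n i j = 1 := by
  have : (i : ℕ) ≡ j [MOD 2] := by
    rw [Nat.even_iff, Nat.even_iff] at h; unfold Nat.ModEq; omega
  simp [altMatrix, this]

theorem altMatrix_eq_three {n : ℕ} {i j : Fin n} (h : ¬(Even (i : ℕ) ↔ Even (j : ℕ))) :
    altMatrix n i j = 3 := by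
  have : ¬(i : ℕ) ≡ j [MOD 2] := by
    rw [Nat.even_iff, Nat.even_iff] at h; unfold Nat.ModEq; omega
  simp [altMatrix, this]

theorem map_altProd {G H : Type*} [Group G] [Group H] (f : G →* H) (m : ℕ) (x y : G) :
    f (altProd m x y) = altProd m (f x) (f y) := by
  induction m generalizing x y with
  | zero => simp [altProd]
  | succ m ih => simp [altProd, ih]

theorem altProd_one {G : Type*} [Group G] (x y : G) : altProd 1 x y = x := by simp [altProd]

theorem altProd_three {G : Type*} [Group G] (x y : G) : altProd 3 x y = x * y * x := by
  simp [altProd, mul_assoc]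

/-- Two entries of an alternating tuple satisfy the Artin relation prescribed by the matrix. -/
theorem altProd_alternating {G : Type*} [Group G] {n : ℕ} {x y : G} (h : x * y * x = y * x * y)
    (i j : Fin n) :
    altProd (altMatrix n i j) (alternating n x y i) (alternating n x y j) =
      altProd (altMatrix n i j) (alternating n x y j) (alternating n x y i) := by
  by_cases hi : Even (i : ℕ) <;> by_cases hj : Even (j : ℕ) <;>
    simp [alternating, hi, hj, altMatrix_eq_one, altMatrix_eq_three, altProd_three, h]

theorem artinSystem_relation {n : ℕ} (M : Matrix (Fin n) (Fin n) ℕ) (i j : Fin n) :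
    altProd (M i j) (artinSystem M i) (artinSystem M j) =
      altProd (M i j) (artinSystem M j) (artinSystem M i) := by
  have := PresentedGroup.one_of_mem (rels := {r : FreeGroup (Fin n) | ∃ i j,
      r = altProd (M i j) (FreeGroup.of i) (FreeGroup.of j) *
        (altProd (M i j) (FreeGroup.of j) (FreeGroup.of i))⁻¹}) ⟨i, j, rfl⟩
  rw [map_mul, map_inv, mul_inv_eq_one, map_altProd, map_altProd] at this
  exact this

theorem artinSystem_altMatrix {n : ℕ} (hn : 2 ≤ n) :
    artinSystem (altMatrix n) = alternating n (artinSystem (altMatrix n) ⟨0, by omega⟩)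
      (artinSystem (altMatrix n) ⟨1, by omega⟩) := by
  funext i
  by_cases hi : Even (i : ℕ)
  · have := artinSystem_relation (altMatrix n) i ⟨0, by omega⟩
    rw [altMatrix_eq_one (by simp [hi]), altProd_one, altProd_one] at this
    simpa [alternating, hi] using this
  · have := artinSystem_relation (altMatrix n) i ⟨1, by omega⟩
    rw [altMatrix_eq_one (by simp [hi]), altProd_one, altProd_one] at this
    simpa [alternating, hi] using this

theorem hurwitzStabilizer_artinSystem {n : ℕ} (hn : 2 ≤ n) :
    hurwitzStabilizer (artinSystem (altMatrix n)) = hurwitzStabilizer (altArtin n) := by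
  apply le_antisymm
  · let f : ArtinGroupOf (altMatrix n) →* BraidGroup 3 :=
      PresentedGroup.toGroup (f := altArtin n) (by
        rintro r ⟨i, j, rfl⟩
        rw [map_mul, map_inv, mul_inv_eq_one, map_altProd, map_altProd, FreeGroup.lift_apply_of,
          FreeGroup.lift_apply_of]
        exact altProd_alternating (sigma_braid (by omega)) i j)
    have hf : f ∘ artinSystem (altMatrix n) = altArtin n := by
      funext i; simp [f, artinSystem]
    exact hf ▸ hurwitzStabilizer_le_comp f _
  · rw [artinSystem_altMatrix hn]
    apply hurwitzStabilizer_altArtin_le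
    have := artinSystem_relation (altMatrix n) ⟨0, by omega⟩ ⟨1, by omega⟩
    rwa [altMatrix_eq_three (by simp), altProd_three, altProd_three] at this

theorem hurwitzStabilizer_coxeterSystem {n : ℕ} (hn : 2 ≤ n) :
    hurwitzStabilizer (coxeterSystem (altMatrix n)) = hurwitzStabilizer (altCoxeter n) := by
  have hsq (i) : coxeterSystem (altMatrix n) i * coxeterSystem (altMatrix n) i = 1 := by
    rw [← pow_two]
    exact PresentedGroup.one_of_mem (Or.inl ⟨i, rfl⟩)
  have hpow (i j) : (coxeterSystem (altMatrix n) i * coxeterSystem (altMatrix n) j) ^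
      altMatrix n i j = 1 :=
    PresentedGroup.one_of_mem (Or.inr ⟨i, j, rfl⟩)
  set s := coxeterSystem (altMatrix n) ⟨0, by omega⟩ with hs
  set t := coxeterSystem (altMatrix n) ⟨1, by omega⟩ with ht
  have hss : s * s = 1 := hsq _
  have htt : t * t = 1 := hsq _
  have hst : t * s * t = s * t * s := by
    have := hpow ⟨0, by omega⟩ ⟨1, by omega⟩
    rw [altMatrix_eq_three (by simp), ← hs, ← ht, pow_three] at this
    have hs' : s⁻¹ = s := inv_eq_of_mul_eq_one_right hss
    have ht' : t⁻¹ = t := inv_eq_of_mul_eq_one_right htt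
    calc t * s * t = (s * t * s)⁻¹ * (s * t * (s * t * (s * t))) := by group
      _ = s * t * s := by rw [this]; simp [hs', ht', mul_assoc]
  have hgen (i : Fin n) : coxeterSystem (altMatrix n) i = s ∨
      coxeterSystem (altMatrix n) i = t := by
    by_cases hi : Even (i : ℕ)
    · have := hpow i ⟨0, by omega⟩
      rw [altMatrix_eq_one (by simp [hi]), pow_one] at this
      exact Or.inl (mul_right_cancel (this.trans hss.symm))
    · have := hpow i ⟨1, by omega⟩
      rw [altMatrix_eq_one (by simp [hi]), pow_one] at this
      exact Or.inr (mul_right_cancel (this.trans htt.symm))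
  let f : CoxeterGroupOf (altMatrix n) →* Equiv.Perm (Fin 3) :=
    PresentedGroup.toGroup (f := altCoxeter n) (by
      rintro r (⟨i, rfl⟩ | ⟨i, j, rfl⟩)
      · rw [map_pow, FreeGroup.lift_apply_of]
        by_cases hi : Even (i : ℕ) <;> simp only [altCoxeter, alternating, hi, if_true, if_false]
          <;> decide
      · rw [map_pow, map_mul, FreeGroup.lift_apply_of, FreeGroup.lift_apply_of]
        by_cases hi : Even (i : ℕ) <;> by_cases hj : Even (j : ℕ) <;>
          simp only [altCoxeter, alternating, hi, hj, if_true, if_false] <;>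
          first
          | rw [altMatrix_eq_one (by simp [hi, hj])]; decide
          | rw [altMatrix_eq_three (by simp [hi, hj])]; decide)
  have hf (i) : f (coxeterSystem (altMatrix n) i) = altCoxeter n i := by
    simp [f, coxeterSystem]
  have hfs : f s = Equiv.swap 0 1 := (hf _).trans (by simp [altCoxeter, alternating])
  have hft : f t = Equiv.swap 1 2 := (hf _).trans (by simp [altCoxeter, alternating])
  -- The group has at most six elements, on which `f` is injective.
  have hmul (a : CoxeterGroupOf (altMatrix n)) : s * (s * a) = a ∧ t * (t * a) = a ∧
      t * (s * (t * a)) = s * (t * (s * a)) := by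
    simp only [← mul_assoc, hss, htt, hst, one_mul, and_self]
  have helem (x : CoxeterGroupOf (altMatrix n)) : x = 1 ∨ x = s ∨ x = t ∨ x = s * t ∨
      x = t * s ∨ x = s * (t * s) := by
    have hx : x ∈ Subgroup.closure (Set.range (PresentedGroup.of :
        Fin n → CoxeterGroupOf (altMatrix n))) := by
      rw [PresentedGroup.closure_range_of]; trivial
    have hstep (i : Fin n) (y : CoxeterGroupOf (altMatrix n)) (hy : y = 1 ∨ y = s ∨ y = t ∨
        y = s * t ∨ y = t * s ∨ y = s * (t * s)) :
        coxeterSystem (altMatrix n) i * y = 1 ∨ coxeterSystem (altMatrix n) i * y = s ∨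
        coxeterSystem (altMatrix n) i * y = t ∨ coxeterSystem (altMatrix n) i * y = s * t ∨
        coxeterSystem (altMatrix n) i * y = t * s ∨
        coxeterSystem (altMatrix n) i * y = s * (t * s) := by
      have hst' : t * (s * t) = s * (t * s) := by simpa only [mul_assoc] using hst
      rcases hgen i with h | h <;> rw [h] <;>
        rcases hy with rfl | rfl | rfl | rfl | rfl | rfl <;>
        simp only [mul_one, hss, htt, hmul, hst', true_or, or_true]
    induction hx using Subgroup.closure_induction_left with
    | one => exact Or.inl rfl
    | mul_left x hx y _ ih =>
      obtain ⟨i, rfl⟩ := hx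
      exact hstep i y ih
    | inv_mul_cancel x hx y _ ih =>
      obtain ⟨i, rfl⟩ := hx
      have hi : (PresentedGroup.of i)⁻¹ = coxeterSystem (altMatrix n) i :=
        inv_eq_of_mul_eq_one_right (hsq i)
      rw [hi]
      exact hstep i y ih
  have hinj : Function.Injective f := by
    rw [injective_iff_map_eq_one]
    intro x hx
    rcases helem x with rfl | rfl | rfl | rfl | rfl | rfl
    · rfl
    all_goals
      simp only [map_mul, hfs, hft] at hx
      exact absurd hx (by decide)
  have hcomp : f ∘ coxeterSystem (altMatrix n) = altCoxeter n := funext hf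
  rw [← hcomp, hurwitzStabilizer_comp_of_injective f hinj]

/-! ### The band subgroup -/

theorem descProd_succ_self (n i : ℕ) : descProd n i (i + 1) = 1 := by simp [descProd]

theorem descProd_succ (n : ℕ) {i j : ℕ} (h : i < j) :
    descProd n i (j + 1) = sigma n j * descProd n i j := by
  simp [descProd, List.Ico.succ_top (show i + 1 ≤ j by omega)]

theorem descProd_eq_mul (n : ℕ) {i j : ℕ} (h : i + 1 < j) :
    descProd n i j = descProd n (i + 1) j * sigma n (i + 1) := by
  simp [descProd, List.Ico.eq_cons h]

theorem commute_descProd {n i j k : ℕ} (h : k < i) : Commute (sigma n k) (descProd n i j) := by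
  refine Commute.list_prod_right _ _ fun x hx => ?_
  obtain ⟨l, hl, rfl⟩ := List.mem_map.mp hx
  rw [List.mem_reverse, List.Ico.mem] at hl
  exact sigma_comm (by omega)

/-- Moving the entry in position `j` to position `i + 1` past the entries in between. -/
theorem hurwitzAction_descProd_inv {n i j : ℕ} {G : Type*} [Group G] (hij : i < j) (hj : j < n)
    (t : Fin n → G) :
    hurwitzAction n G (descProd n i j)⁻¹ t ⟨i, by omega⟩ = t ⟨i, by omega⟩ ∧
      hurwitzAction n G (descProd n i j)⁻¹ t ⟨i + 1, by omega⟩ = t ⟨j, hj⟩ := by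
  induction j, hij using Nat.le_induction generalizing t with
  | base => simp [descProd_succ_self]
  | succ j hij ih =>
    have hs : hurwitzAction n G (sigma n j)⁻¹ t = (hurwitzMove ⟨j, by omega⟩).symm t := by
      rw [map_inv, hurwitzAction_sigma (by omega)]; rfl
    rw [descProd_succ n (by omega), mul_inv_rev, map_mul, Equiv.Perm.mul_apply, hs]
    obtain ⟨h1, h2⟩ := ih (by omega) ((hurwitzMove ⟨j, by omega⟩).symm t)
    rw [h1, h2]
    have e1 : i ≠ j := by omega
    have e2 : i ≠ j + 1 := by omega
    simp [hurwitzMove, e1, e2]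

theorem hurwitzAction_sigma_pow_altMatrix {n i m : ℕ} {G : Type*} [Group G] (hi : i + 1 < n)
    (hm : m = 1 ∨ m = 3) (t : Fin n → G)
    (h : altProd m (t ⟨i, by omega⟩) (t ⟨i + 1, hi⟩) =
      altProd m (t ⟨i + 1, hi⟩) (t ⟨i, by omega⟩)) :
    hurwitzAction n G (sigma n i ^ m) t = t := by
  rw [map_pow, hurwitzAction_sigma (by omega)]
  rcases hm with rfl | rfl
  · rw [altProd_one, altProd_one] at h
    funext ⟨k, hk⟩
    simp only [pow_one, hurwitzMove, Equiv.coe_fn_mk, h, mul_inv_cancel_right]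
    split_ifs with h1 h2
    · subst h1; exact h.symm
    · subst h2; rfl
    · rfl
  · rw [altProd_three, altProd_three] at h
    simp only [pow_three, Equiv.Perm.mul_apply]
    generalize hx : t ⟨i, by omega⟩ = x at h
    generalize hy : t ⟨i + 1, hi⟩ = y at h
    -- the form of the braid relation that occurs when the three moves are carried out
    have h' : x * y * x⁻¹ = y⁻¹ * x * y := by
      rw [mul_inv_eq_iff_eq_mul, mul_assoc, mul_assoc, eq_inv_mul_iff_mul_eq, ← mul_assoc,
        ← mul_assoc, h]
    funext ⟨k, hk⟩
    by_cases h1 : k = i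
    · subst h1
      simp [hurwitzMove, hx, hy, h', mul_assoc]
    · by_cases h2 : k = i + 1
      · subst h2
        simp [hurwitzMove, hx, hy]
        rw [← mul_assoc, ← mul_assoc, h]; group
      · simp [hurwitzMove, h1, h2]

theorem altMatrix_eq_one_or {n : ℕ} (i j : Fin n) : altMatrix n i j = 1 ∨ altMatrix n i j = 3 := by
  unfold altMatrix; split_ifs <;> simp

theorem bandSubgroup_le_hurwitzStabilizer (n : ℕ) :
    bandSubgroup (altMatrix n) ≤ hurwitzStabilizer (altArtin n) := by
  refine (Subgroup.closure_le _).mpr ?_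
  rintro _ ⟨⟨i, hi⟩, ⟨j, hj⟩, hij, rfl⟩
  have hij' : i < j := hij
  rw [SetLike.mem_coe, mem_hurwitzStabilizer, bandPow, map_mul, map_mul, map_inv,
    Equiv.Perm.mul_apply, Equiv.Perm.mul_apply, ← Equiv.Perm.eq_inv_iff_eq, ← map_inv]
  obtain ⟨h1, h2⟩ := hurwitzAction_descProd_inv hij' hj (altArtin n)
  apply hurwitzAction_sigma_pow_altMatrix (by omega) (altMatrix_eq_one_or _ _)
  rw [h1, h2]
  exact altProd_alternating (sigma_braid (by omega)) _ _

/-- The half twist exchanging the strands in positions `k` and `k + 2`. -/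
def skipTwist (n k : ℕ) : BraidGroup n := sigma n (k + 1) * sigma n k * (sigma n (k + 1))⁻¹

theorem bandPow_succ (n m i : ℕ) : bandPow n m i (i + 1) = sigma n i ^ m := by
  simp [bandPow, descProd_succ_self]

theorem bandPow_one_add_two (n i : ℕ) : bandPow n 1 i (i + 2) = skipTwist n i := by
  simp [bandPow, descProd_eq_mul n (show i + 1 < i + 2 by omega), descProd_succ_self, skipTwist]

theorem sigma_pow_three_mem_bandSubgroup {n k : ℕ} (hk : k + 1 < n) :
    sigma n k ^ 3 ∈ bandSubgroup (altMatrix n) := by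
  refine Subgroup.subset_closure ⟨⟨k, by omega⟩, ⟨k + 1, hk⟩, by simp, ?_⟩
  rw [altMatrix_eq_three (by simp only [Nat.even_add_one]; tauto), bandPow_succ]

theorem skipTwist_mem_bandSubgroup {n k : ℕ} (hk : k + 2 < n) :
    skipTwist n k ∈ bandSubgroup (altMatrix n) := by
  refine Subgroup.subset_closure ⟨⟨k, by omega⟩, ⟨k + 2, hk⟩, by simp, ?_⟩
  rw [altMatrix_eq_one (by simp [Nat.even_add]), bandPow_one_add_two]

theorem sigma_succ_eq_conj {n k : ℕ} (hk : k + 2 < n) :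
    sigma n (k + 1) = (skipTwist n k)⁻¹ * sigma n k * skipTwist n k := by
  rw [mul_assoc, eq_inv_mul_iff_mul_eq, skipTwist, inv_mul_cancel_right, ← mul_assoc, ← mul_assoc,
    sigma_braid hk, mul_inv_cancel_right]

/-- The triangle relation among the half twists along the sides of the triangle with vertices
`i`, `i + 2`, `j`. -/
theorem bandPow_eq_conj {n m i j : ℕ} (hij : i + 2 < j) (hj : j < n) :
    bandPow n m i j = (skipTwist n i)⁻¹ * bandPow n m (i + 2) j * skipTwist n i := by
  have h1 := sigma_comm (n := n) (show i + 2 ≤ i + 2 by omega)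
  have h2 := sigma_braid (n := n) (k := i) (by omega)
  have h3 := sigma_braid (n := n) (k := i + 1) (by omega)
  have hx : Commute (skipTwist n i) (descProd n (i + 2) j) :=
    ((commute_descProd (by omega)).mul_left (commute_descProd (by omega))).mul_left
      (commute_descProd (by omega)).inv_left
  rw [bandPow, bandPow, descProd_eq_mul n (show i + 1 < j by omega),
    descProd_eq_mul n (show i + 1 + 1 < j by omega)]
  set D := descProd n (i + 1 + 1) j
  have hxi : skipTwist n i = (sigma n i)⁻¹ * sigma n (i + 1) * sigma n i := by
    rw [skipTwist, mul_inv_eq_iff_eq_mul, mul_assoc, mul_assoc, eq_inv_mul_iff_mul_eq, ← mul_assoc,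
      ← mul_assoc, h2]
  have key : sigma n (i + 2) * skipTwist n i * (sigma n (i + 2))⁻¹ =
      (skipTwist n i)⁻¹ * sigma n (i + 2) * skipTwist n i := by
    rw [mul_inv_eq_iff_eq_mul, mul_assoc, mul_assoc, eq_inv_mul_iff_mul_eq, hxi]
    generalize sigma n i = a at *
    generalize sigma n (i + 1) = b at *
    generalize sigma n (i + 2) = c at *
    calc a⁻¹ * b * a * (c * (a⁻¹ * b * a)) = a⁻¹ * b * (a * c) * a⁻¹ * b * a := by group
      _ = a⁻¹ * (b * c * b) * a := by rw [h1.eq]; group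
      _ = a⁻¹ * c * b * (c * a) := by rw [h3]; group
      _ = (a⁻¹ * c) * b * a * c := by rw [← h1.eq]; group
      _ = c * a⁻¹ * b * a * c := by rw [h1.inv_left.eq]
      _ = c * (a⁻¹ * b * a * c) := by group
  calc D * sigma n (i + 1 + 1) * sigma n (i + 1) * sigma n i ^ m *
        (D * sigma n (i + 1 + 1) * sigma n (i + 1))⁻¹
      = D * (sigma n (i + 2) * (sigma n (i + 1) * sigma n i ^ m * (sigma n (i + 1))⁻¹) *
          (sigma n (i + 2))⁻¹) * D⁻¹ := by group
    _ = D * (sigma n (i + 2) * skipTwist n i * (sigma n (i + 2))⁻¹) ^ m * D⁻¹ := by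
        rw [conj_pow, skipTwist, conj_pow]
    _ = D * (skipTwist n i)⁻¹ * sigma n (i + 2) ^ m * (skipTwist n i * D⁻¹) := by
        rw [key]
        have := conj_pow (a := (skipTwist n i)⁻¹) (b := sigma n (i + 2)) (i := m)
        rw [inv_inv] at this
        rw [this]; group
    _ = (skipTwist n i)⁻¹ * (D * sigma n (i + 2) ^ m * D⁻¹) * skipTwist n i := by
        rw [hx.inv_right.eq, ← hx.inv_left.eq]; group

/-- The band subgroup of the alternating matrix is generated by the cube of the first generator and
the half twists exchanging strands at distance two. -/
theorem bandSubgroup_altMatrix_le {n : ℕ} {H : Subgroup (BraidGroup n)}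
    (h0 : sigma n 0 ^ 3 ∈ H) (hk : ∀ k, k + 2 < n → skipTwist n k ∈ H) :
    bandSubgroup (altMatrix n) ≤ H := by
  have hcube : ∀ k, k + 1 < n → sigma n k ^ 3 ∈ H := by
    intro k hkn
    induction k with
    | zero => exact h0
    | succ k ih =>
      have := conj_pow (a := (skipTwist n k)⁻¹) (b := sigma n k) (i := 3)
      rw [inv_inv] at this
      rw [sigma_succ_eq_conj hkn, this]
      exact H.mul_mem (H.mul_mem (H.inv_mem (hk k hkn)) (ih (by omega))) (hk k hkn)
  have key : ∀ d i j : ℕ, i < j → j ≤ i + d → j < n →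
      bandPow n (if i ≡ j [MOD 2] then 1 else 3) i j ∈ H := by
    intro d
    induction d with
    | zero => omega
    | succ d ih =>
      intro i j hij hjd hj
      rcases (by omega : j = i + 1 ∨ j = i + 2 ∨ i + 2 < j) with rfl | rfl | h
      · rw [if_neg (by unfold Nat.ModEq; omega), bandPow_succ]
        exact hcube i hj
      · rw [if_pos (by unfold Nat.ModEq; omega), bandPow_one_add_two]
        exact hk i hj
      · have hpar : i ≡ j [MOD 2] ↔ i + 2 ≡ j [MOD 2] := by unfold Nat.ModEq; omega
        rw [bandPow_eq_conj h hj]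
        simp only [hpar]
        exact H.mul_mem (H.mul_mem (H.inv_mem (hk i (by omega))) (ih _ _ h (by omega) hj))
          (hk i (by omega))
  refine (Subgroup.closure_le _).mpr ?_
  rintro _ ⟨i, j, hij, rfl⟩
  exact key n i j hij (by omega) j.2

/-! ### Braids on a window of consecutive strands -/

/-- The homomorphism from the braid group on `m` strands that lets a braid act on the strands in
the positions `d`, …, `d + m - 1`. -/
def windowHom {m n : ℕ} (d : ℕ) (h : m + d ≤ n) : BraidGroup m →* BraidGroup n :=
  PresentedGroup.toGroup (f := fun i : Fin (m - 1) => sigma n (i + d)) (by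
    rintro r (⟨i, j, hij, rfl⟩ | ⟨i, j, hij, rfl⟩)
    · simp only [map_mul, map_inv, FreeGroup.lift_apply_of, mul_inv_eq_one]
      rw [show (j : ℕ) + d = i + d + 1 by omega]
      exact sigma_braid (by omega)
    · simp only [map_mul, map_inv, FreeGroup.lift_apply_of, mul_inv_eq_one]
      exact sigma_comm (by omega))

theorem windowHom_sigma {m n d : ℕ} (h : m + d ≤ n) {k : ℕ} (hk : k < m - 1) :
    windowHom d h (sigma m k) = sigma n (k + d) := by
  rw [sigma_of_lt hk]; simp [windowHom]

/-- The part of a tuple in the positions `d`, …, `d + m - 1`. -/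
def window {m n : ℕ} {G : Type*} (d : ℕ) (h : m + d ≤ n) (t : Fin n → G) : Fin m → G :=
  fun i => t ⟨i + d, by omega⟩

theorem window_hurwitzAction {m n d : ℕ} {G : Type*} [Group G] (h : m + d ≤ n) (b : BraidGroup m)
    (t : Fin n → G) :
    window d h (hurwitzAction n G (windowHom d h b) t) = hurwitzAction m G b (window d h t) := by
  induction b using BraidGroup.induction generalizing t with
  | one => simp
  | sigma k hk =>
    rw [windowHom_sigma h hk, hurwitzAction_sigma hk, hurwitzAction_sigma (by omega)]
    funext i
    simp only [window, hurwitzMove, Equiv.coe_fn_mk]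
    have e1 : (i : ℕ) + d = k + d ↔ (i : ℕ) = k := by omega
    have e2 : (i : ℕ) + d = k + 1 + d ↔ (i : ℕ) = k + 1 := by omega
    have e3 : k + d + 1 = k + 1 + d := by omega
    simp only [e3, e1, e2]
  | mul a b ha hb => simp [ha, hb]
  | inv a ha =>
    rw [map_inv, map_inv, map_inv, Equiv.Perm.eq_inv_iff_eq, ← ha]
    simp

theorem hurwitzAction_windowHom_apply {m n d : ℕ} {G : Type*} [Group G] (h : m + d ≤ n)
    (b : BraidGroup m) (t : Fin n → G) (i : Fin n) (hi : (i : ℕ) < d ∨ m + d ≤ i) :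
    hurwitzAction n G (windowHom d h b) t i = t i := by
  induction b using BraidGroup.induction generalizing t with
  | one => simp
  | sigma k hk =>
    rw [windowHom_sigma h hk, hurwitzAction_sigma (by omega)]
    have e1 : (i : ℕ) ≠ k + d := by omega
    have e2 : (i : ℕ) ≠ k + d + 1 := by omega
    simp [hurwitzMove, e1, e2]
  | mul a b ha hb => simp [ha, hb]
  | inv a ha =>
    have := ha (hurwitzAction n G (windowHom d h a⁻¹) t)
    rw [← Equiv.Perm.mul_apply, ← map_mul, ← map_mul] at this
    simpa using this.symm

theorem windowHom_mem_hurwitzStabilizer {m n d : ℕ} {G : Type*} [Group G] (h : m + d ≤ n)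
    {b : BraidGroup m} {t : Fin n → G} :
    windowHom d h b ∈ hurwitzStabilizer t ↔ b ∈ hurwitzStabilizer (window d h t) := by
  simp only [mem_hurwitzStabilizer]
  refine ⟨fun hb => by rw [← window_hurwitzAction, hb], fun hb => ?_⟩
  funext i
  by_cases hi : (i : ℕ) < d ∨ m + d ≤ i
  · exact hurwitzAction_windowHom_apply h b t i hi
  · have := congrFun (window_hurwitzAction h b t) ⟨i - d, by omega⟩
    rw [hb] at this
    have e : (i : ℕ) - d + d = i := by omega
    simpa [window, e] using this

theorem window_alternating_even {m n d : ℕ} {G : Type*} [Group G] (h : m + d ≤ n) (hd : Even d)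
    (x y : G) : window d h (alternating n x y) = alternating m x y := by
  funext i; simp [window, alternating, Nat.even_add, hd]

theorem window_alternating_odd {m n d : ℕ} {G : Type*} [Group G] (h : m + d ≤ n) (hd : ¬Even d)
    (x y : G) : window d h (alternating n x y) = alternating m y x := by
  funext i
  by_cases hi : Even (i : ℕ) <;> simp [window, alternating, Nat.even_add, hd, hi]

theorem windowHom_mem_bandSubgroup {m n d : ℕ} (h : m + d ≤ n) (hm : 2 ≤ m) {b : BraidGroup m}
    (hb : b ∈ bandSubgroup (altMatrix m)) :
    windowHom d h b ∈ bandSubgroup (altMatrix n) := by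
  have : bandSubgroup (altMatrix m) ≤ (bandSubgroup (altMatrix n)).comap (windowHom d h) := by
    apply bandSubgroup_altMatrix_le
    · rw [Subgroup.mem_comap, map_pow, windowHom_sigma h (by omega)]
      exact sigma_pow_three_mem_bandSubgroup (by omega)
    · intro k hk
      rw [Subgroup.mem_comap, skipTwist, map_mul, map_mul, map_inv, windowHom_sigma h (by omega),
        windowHom_sigma h (by omega), show k + 1 + d = k + d + 1 by omega]
      exact skipTwist_mem_bandSubgroup (by omega)
  exact this hb

/-! ### Coset enumeration -/

/-- The coset table: entry `i` of row `k` is the number of the coset to which the `i`-th generator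
sends the `k`-th coset. On `n` strands only the first `n - 1` columns are used, and only the first
3, 8, 27 rows for `n = 2, 3, 4`. -/
def cosetTable : List (List ℕ) :=
  [[1, 3, 8, 27, 17], [2, 1, 9, 28, 14], [0, 4, 10, 29, 16], [5, 6, 3, 30, 22], [4, 5, 11, 31, 21],
   [7, 2, 5, 32, 25], [6, 0, 12, 33, 11], [3, 7, 7, 34, 26], [9, 13, 14, 8, 2], [10, 15, 16, 9, 0],
   [8, 10, 17, 10, 1], [11, 17, 18, 4, 20], [12, 12, 13, 24, 18], [13, 19, 6, 13, 4], [16, 14, 0, 7, 10],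
   [19, 20, 15, 15, 3], [17, 21, 1, 3, 8], [14, 22, 2, 5, 9], [18, 18, 4, 18, 24], [23, 8, 19, 19, 5],
   [20, 9, 24, 20, 6], [21, 25, 20, 6, 13], [25, 11, 22, 2, 15], [15, 23, 23, 23, 7], [24, 24, 21, 35, 12],
   [26, 16, 25, 0, 19], [22, 26, 26, 1, 23], [28, 30, 34, 25, 27], [29, 28, 30, 26, 28], [27, 31, 32, 22, 29],
   [32, 33, 36, 16, 30], [31, 32, 31, 11, 31], [34, 29, 37, 17, 32], [33, 27, 33, 21, 33], [30, 34, 38, 14, 34],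
   [35, 35, 35, 12, 35], [37, 38, 28, 36, 36], [38, 37, 29, 37, 37], [36, 39, 27, 38, 38], [39, 36, 39, 39, 39]]

/-- Positive words leading from coset number `0` to the cosets; the last letter is applied first. -/
def cosetWords : List (List ℕ) :=
  [[], [0], [0, 0], [1], [1, 0, 0],
   [0, 1], [1, 1], [0, 0, 1], [2], [2, 0],
   [2, 0, 0], [2, 1, 0, 0], [2, 1, 1], [1, 2], [2, 2],
   [1, 2, 0], [2, 2, 0], [2, 2, 0, 0], [2, 2, 1, 0, 0], [1, 1, 2],
   [1, 1, 2, 0], [1, 2, 2, 0], [1, 2, 2, 0, 0], [0, 1, 1, 2], [2, 1, 1, 2, 0],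
   [1, 1, 2, 2, 0], [0, 1, 1, 2, 2, 0], [3], [3, 0], [3, 0, 0],
   [3, 1], [3, 1, 0, 0], [3, 0, 1], [3, 1, 1], [3, 0, 0, 1],
   [3, 2, 1, 1, 2, 0], [2, 3, 1], [2, 3, 0, 1], [2, 3, 0, 0, 1], [1, 2, 3, 0, 0, 1]]

/-- The number of the coset to which the `i`-th generator sends the `k`-th coset. -/
def cosetStep (i k : ℕ) : ℕ := (cosetTable.getD k []).getD i 0

/-- The element of a group spelled by the `k`-th coset word. -/
def cosetRep {G : Type*} [Group G] (s : ℕ → G) (k : ℕ) : G := ((cosetWords.getD k []).map s).prod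

/-- Entry `i` of row `k` of the coset table is realised by the orbit of `y` under the group
elements `s`. -/
def Realised {G α : Type*} [Group G] [MulAction G α] (s : ℕ → G) (y : α) (k i : ℕ) : Prop :=
  s i • cosetRep s k • y = cosetRep s (cosetStep i k) • y

/-- Bit number `5 * k + i` of `F` records whether entry `i` of row `k` of the coset table is known
to be realised. -/
def known (F k i : ℕ) : Bool := F.testBit (5 * k + i)

/-- Record entry `i` of row `k` as known if the condition `c` holds. -/
def learn (c : Bool) (k i F : ℕ) : ℕ := if c then F ||| 1 <<< (5 * k + i) else F

/-- Read off what the braid relation of the generators `i`, `j` says at the `k`-th coset: if all but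
one of the six table entries on the two sides are known, so is the sixth. The entries on the right
hand side are treated when `i` and `j` change roles. -/
def learnBraid (i j k F : ℕ) : ℕ :=
  let k₁ := cosetStep i k
  let k₂ := cosetStep j k₁
  let l₁ := cosetStep j k
  let l₂ := cosetStep i l₁
  if known F k j && known F l₁ i && known F l₂ j && cosetStep i k₂ == cosetStep j l₂ then
    learn (known F k₁ j && known F k₂ i) k i
      (learn (known F k i && known F k₂ i) k₁ j
        (learn (known F k i && known F k₁ j) k₂ i F))
  else F

/-- Read off what the commutation of the generators `i`, `j` says at the `k`-th coset. -/
def learnComm (i j k F : ℕ) : ℕ :=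
  let k₁ := cosetStep i k
  let l₁ := cosetStep j k
  if known F k j && known F l₁ i && cosetStep j k₁ == cosetStep i l₁ then
    learn (known F k₁ j) k i (learn (known F k i) k₁ j F)
  else F

/-- Read off what the relation of the generators `i`, `j` says at the `k`-th coset. -/
def learnRelation (i j k F : ℕ) : ℕ :=
  if i + 1 = j ∨ j + 1 = i then learnBraid i j k F
  else if i = j then F else learnComm i j k F

/-- Fold `f` over a list, evaluating the accumulated natural number to a numeral before each step
(a plain `List.foldl` would make the kernel build up a deeply nested term). -/
def strictFold (f : ℕ → ℕ → ℕ) : List ℕ → ℕ → ℕ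
  | [], F => F
  | k :: l, 0 => strictFold f l (f k 0)
  | k :: l, F + 1 => strictFold f l (f k (F + 1))

/-- One round through the relations of the first `m` generators at the first `N` cosets. -/
def learnRound (m N : ℕ) : ℕ → ℕ :=
  strictFold (fun k => strictFold (fun i => strictFold (fun j => learnRelation i j k)
    (List.range m)) (List.range m)) (List.range N)

/-- The table entries that hold because of the choice of the coset words. -/
def learnTree (m N : ℕ) : ℕ → ℕ :=
  strictFold (fun k => strictFold (fun i =>
    learn (cosetWords.getD (cosetStep i k) [] == i :: cosetWords.getD k []) k i)
    (List.range m)) (List.range N)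

/-- All table entries in the first `m` columns of the first `N` rows become known in four rounds
from those in `L`, and these columns permute the first `N` cosets. -/
def completes (m N : ℕ) (L : List (ℕ × ℕ)) : Bool :=
  let F := (learnRound m N)^[4] (learnTree m N (L.foldl (fun F p => learn true p.1 p.2 F) 0))
  (List.range N).all fun k => (List.range m).all fun i =>
    known F k i && decide (cosetStep i k < N) &&
      (List.range N).any fun l => cosetStep i l == k

section Soundness

variable {G α : Type*} [Group G] [MulAction G α] {s : ℕ → G} {y : α}

/-- All table entries recorded in `F` are realised. -/
def Sound (s : ℕ → G) (y : α) (F : ℕ) : Prop :=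
  ∀ k i, i < 5 → known F k i = true → Realised s y k i

theorem Sound.learn {F k i : ℕ} {c : Bool} (hF : Sound s y F) (hi : i < 5)
    (h : c = true → Realised s y k i) : Sound s y (learn c k i F) := by
  unfold _root_.learn
  split_ifs with hc
  · intro k' i' hi' hk
    rw [known, Nat.testBit_or, Nat.one_shiftLeft, Nat.testBit_two_pow, Bool.or_eq_true] at hk
    rcases hk with hk | hk
    · exact hF k' i' hi' hk
    · have hk := of_decide_eq_true hk
      obtain rfl : k' = k := by omega
      obtain rfl : i' = i := by omega
      exact h hc
  · exact hF

theorem Sound.learnBraid {i j k F : ℕ} (hF : Sound s y F) (hi : i < 5) (hj : j < 5)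
    (h : s i * s j * s i = s j * s i * s j) : Sound s y (learnBraid i j k F) := by
  unfold _root_.learnBraid
  dsimp only
  split_ifs with hc
  · simp only [Bool.and_eq_true, beq_iff_eq] at hc
    obtain ⟨⟨⟨h1, h2⟩, h3⟩, h4⟩ := hc
    have h1 := hF _ _ hj h1
    have h2 := hF _ _ hi h2
    have h3 := hF _ _ hj h3
    unfold Realised at h1 h2 h3
    have hact : s i • s j • s i • cosetRep s k • y =
        cosetRep s (cosetStep i (cosetStep j (cosetStep i k))) • y := by
      rw [h4, ← h3, ← h2, ← h1]
      simp only [← mul_smul, ← mul_assoc, h]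
    refine ((hF.learn hi ?_).learn hj ?_).learn hi ?_
    all_goals
      intro hc
      simp only [Bool.and_eq_true] at hc
      obtain ⟨h5, h6⟩ := hc
    · have h5 := hF _ _ hi h5
      have h6 := hF _ _ hj h6
      unfold Realised at *
      rwa [h5, h6] at hact
    · have h5 := hF _ _ hi h5
      have h6 := hF _ _ hi h6
      unfold Realised at *
      rwa [h5, ← h6, smul_left_cancel_iff] at hact
    · have h5 := hF _ _ hj h5
      have h6 := hF _ _ hi h6
      unfold Realised at *
      rwa [← h6, ← h5, smul_left_cancel_iff, smul_left_cancel_iff] at hact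
  · exact hF

theorem Sound.learnComm {i j k F : ℕ} (hF : Sound s y F) (hi : i < 5) (hj : j < 5)
    (h : s i * s j = s j * s i) : Sound s y (learnComm i j k F) := by
  unfold _root_.learnComm
  dsimp only
  split_ifs with hc
  · simp only [Bool.and_eq_true, beq_iff_eq] at hc
    obtain ⟨⟨h1, h2⟩, h3⟩ := hc
    have h1 := hF _ _ hj h1
    have h2 := hF _ _ hi h2
    unfold Realised at h1 h2
    have hact : s j • s i • cosetRep s k • y =
        cosetRep s (cosetStep j (cosetStep i k)) • y := by
      rw [h3, ← h2, ← h1, ← mul_smul, ← mul_smul (s i), h]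
    refine (hF.learn hj ?_).learn hi ?_
    · intro hc
      have hc := hF _ _ hi hc
      unfold Realised at *
      rwa [hc] at hact
    · intro hc
      have hc := hF _ _ hj hc
      unfold Realised at *
      rwa [← hc, smul_left_cancel_iff] at hact
  · exact hF

theorem Sound.strictFold {f : ℕ → ℕ → ℕ} {l : List ℕ} {F : ℕ} (hF : Sound s y F)
    (hf : ∀ k ∈ l, ∀ F, Sound s y F → Sound s y (f k F)) : Sound s y (strictFold f l F) := by
  induction l generalizing F with
  | nil => exact hF
  | cons k l ih =>
    have : _root_.strictFold f (k :: l) F = _root_.strictFold f l (f k F) := by cases F <;> rfl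
    rw [this]
    exact ih (hf k (by simp) F hF) fun k' hk' => hf k' (by simp [hk'])

theorem Sound.learnRound {m N F : ℕ} (hF : Sound s y F) (hm : m ≤ 5)
    (hbraid : ∀ i, i + 1 < m → s i * s (i + 1) * s i = s (i + 1) * s i * s (i + 1))
    (hcomm : ∀ i j, i + 2 ≤ j → s i * s j = s j * s i) : Sound s y (learnRound m N F) := by
  refine hF.strictFold fun k _ F hF => hF.strictFold fun i hi F hF => hF.strictFold
    fun j hj F hF => ?_
  rw [List.mem_range] at hi hj
  unfold learnRelation
  split_ifs with h1 h2
  · rcases h1 with rfl | rfl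
    · exact hF.learnBraid (by omega) (by omega) (hbraid i hj)
    · exact hF.learnBraid (by omega) (by omega) (hbraid j hi).symm
  · exact hF
  · refine hF.learnComm (by omega) (by omega) ?_
    rcases (by omega : i + 2 ≤ j ∨ j + 2 ≤ i) with h | h
    · exact hcomm i j h
    · exact (hcomm j i h).symm

theorem Sound.learnTree {m N F : ℕ} (hF : Sound s y F) (hm : m ≤ 5) :
    Sound s y (learnTree m N F) := by
  refine hF.strictFold fun k _ F hF => hF.strictFold fun i hi F hF => ?_
  rw [List.mem_range] at hi
  refine hF.learn (by omega) fun h => ?_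
  rw [beq_iff_eq] at h
  rw [Realised, cosetRep, cosetRep, h, List.map_cons, List.prod_cons, mul_smul]

/-- Soundness of the enumeration: if the entries in `L` are realised and `completes` succeeds, all
entries are realised. -/
theorem realised_of_completes {m N : ℕ} {L : List (ℕ × ℕ)} (h : completes m N L = true)
    (hm : m ≤ 5)
    (hbraid : ∀ i, i + 1 < m → s i * s (i + 1) * s i = s (i + 1) * s i * s (i + 1))
    (hcomm : ∀ i j, i + 2 ≤ j → s i * s j = s j * s i)
    (hL : ∀ p ∈ L, p.2 < 5 ∧ Realised s y p.1 p.2) {k i : ℕ} (hk : k < N) (hi : i < m) :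
    Realised s y k i ∧ cosetStep i k < N ∧ ∃ l < N, cosetStep i l = k := by
  have hstart : ∀ (L : List (ℕ × ℕ)) (F : ℕ), Sound s y F →
      (∀ p ∈ L, p.2 < 5 ∧ Realised s y p.1 p.2) →
      Sound s y (L.foldl (fun F p => learn true p.1 p.2 F) F) := by
    intro L
    induction L with
    | nil => exact fun F hF _ => hF
    | cons p L ih =>
      exact fun F hF hL => ih _ (hF.learn (hL p (by simp)).1 fun _ => (hL p (by simp)).2)
        fun q hq => hL q (by simp [hq])
  have hsound : Sound s y ((learnRound m N)^[4]
      (learnTree m N (L.foldl (fun F p => learn true p.1 p.2 F) 0))) := by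
    have h0 := (hstart L 0 (fun k i _ h => by simp [known] at h) hL).learnTree hm (m := m) (N := N)
    simp only [Function.iterate_succ, Function.iterate_zero, Function.comp_apply, id]
    exact (((h0.learnRound hm hbraid hcomm).learnRound hm hbraid hcomm).learnRound hm hbraid
      hcomm).learnRound hm hbraid hcomm
  simp only [completes, List.all_eq_true, List.mem_range, Bool.and_eq_true, decide_eq_true_eq,
    List.any_eq_true, beq_iff_eq] at h
  obtain ⟨⟨h1, h2⟩, h3⟩ := h k hk i hi
  exact ⟨hsound k i (by omega) h1, h2, h3⟩

end Soundness

/-- If the coset table is realised in the orbit of a subgroup `H` of the braid group, then the coset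
words represent all cosets of `H`. -/
theorem exists_cosetRep_of_completes {n N : ℕ} {L : List (ℕ × ℕ)} {H : Subgroup (BraidGroup n)}
    (h : completes (n - 1) N L = true) (hn : n ≤ 6) (hN : 0 < N)
    (hL : ∀ p ∈ L, p.2 < 5 ∧ Realised (sigma n) ((1 : BraidGroup n) : BraidGroup n ⧸ H) p.1 p.2)
    (b : BraidGroup n) : ∃ k < N, (cosetRep (sigma n) k)⁻¹ * b ∈ H := by
  have hr {k i : ℕ} := realised_of_completes (s := sigma n) (k := k) (i := i) h (by omega)
    (fun i hi => sigma_braid (by omega)) (fun i j hij => sigma_comm hij) hL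
  set y := ((1 : BraidGroup n) : BraidGroup n ⧸ H)
  have key : (∀ k < N, ∃ l < N, b • cosetRep (sigma n) k • y = cosetRep (sigma n) l • y) ∧
      ∀ k < N, ∃ l < N, b⁻¹ • cosetRep (sigma n) k • y = cosetRep (sigma n) l • y := by
    induction b using BraidGroup.induction with
    | one => exact ⟨fun k hk => ⟨k, hk, by simp⟩, fun k hk => ⟨k, hk, by simp⟩⟩
    | sigma i hi =>
      refine ⟨fun k hk => ⟨_, (hr hk hi).2.1, (hr hk hi).1⟩, fun k hk => ?_⟩
      obtain ⟨l, hl, rfl⟩ := (hr hk hi).2.2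
      exact ⟨l, hl, by rw [inv_smul_eq_iff]; exact (hr hl hi).1.symm⟩
    | mul a b ha hb =>
      refine ⟨fun k hk => ?_, fun k hk => ?_⟩
      · obtain ⟨l, hl, e⟩ := hb.1 k hk
        obtain ⟨l', hl', e'⟩ := ha.1 l hl
        exact ⟨l', hl', by rw [mul_smul, e, e']⟩
      · obtain ⟨l, hl, e⟩ := ha.2 k hk
        obtain ⟨l', hl', e'⟩ := hb.2 l hl
        exact ⟨l', hl', by rw [mul_inv_rev, mul_smul, e, e']⟩
    | inv a ha => exact ⟨ha.2, by simpa using ha.1⟩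
  obtain ⟨k, hk, e⟩ := key.1 0 hN
  refine ⟨k, hk, ?_⟩
  have e0 : cosetRep (sigma n) 0 = 1 := by simp [cosetRep, cosetWords]
  rw [e0, one_smul] at e
  have := QuotientGroup.eq.mp e.symm
  simpa using this

section Entries

variable {G α : Type*} [Group G] [MulAction G α] {s : ℕ → G} {y : α}

theorem realised_two_zero (h : s 0 ^ 3 • y = y) : Realised s y 2 0 := by
  rw [pow_three] at h
  simpa [Realised, cosetRep, cosetStep, cosetTable, cosetWords, mul_smul] using h

theorem realised_six_one (h : s 1 ^ 3 • y = y) : Realised s y 6 1 := by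
  rw [pow_three] at h
  simpa [Realised, cosetRep, cosetStep, cosetTable, cosetWords, mul_smul] using h

theorem realised_fourteen_two (h : s 2 ^ 3 • y = y) : Realised s y 14 2 := by
  rw [pow_three] at h
  simpa [Realised, cosetRep, cosetStep, cosetTable, cosetWords, mul_smul] using h

theorem smul_sq_smul_of_skip {a b : G} (h3 : b ^ 3 • y = y) (h : (b * a * b⁻¹) • y = y) :
    a • b • b • y = b • b • y := by
  have e : b • b • y = b⁻¹ • y := by
    rw [eq_inv_smul_iff]
    simpa [pow_three, mul_smul] using h3
  rw [e, eq_inv_smul_iff]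
  simpa [mul_smul] using h

theorem realised_six_zero (h3 : s 1 ^ 3 • y = y) (h : (s 1 * s 0 * (s 1)⁻¹) • y = y) :
    Realised s y 6 0 := by
  simpa [Realised, cosetRep, cosetStep, cosetTable, cosetWords, mul_smul] using
    smul_sq_smul_of_skip h3 h

theorem realised_fourteen_one (h3 : s 2 ^ 3 • y = y) (h : (s 2 * s 1 * (s 2)⁻¹) • y = y) :
    Realised s y 14 1 := by
  simpa [Realised, cosetRep, cosetStep, cosetTable, cosetWords, mul_smul] using
    smul_sq_smul_of_skip h3 h

/- In the lists below, `(2, 0)`, `(6, 1)`, `(14, 2)` say that the cubes of the first three generators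
fix coset number `0`, and `(6, 0)`, `(14, 1)` that `skipTwist n 0` and `skipTwist n 1` do. -/

theorem completes_one : completes 1 3 [(2, 0)] = true := by decide +kernel

theorem completes_two : completes 2 8 [(2, 0), (6, 1), (6, 0)] = true := by decide +kernel

theorem completes_three :
    completes 3 27 [(2, 0), (6, 1), (6, 0), (14, 2), (14, 1)] = true := by decide +kernel

theorem completes_four :
    completes 4 40 [(2, 0), (6, 1), (6, 0), (14, 2), (14, 1), (25, 3)] = true := by
  decide +kernel

theorem completes_five :
    completes 5 40 [(2, 0), (6, 1), (6, 0), (14, 2), (14, 1), (0, 4), (17, 3)] = true := by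
  decide +kernel

/-- The step from four to five strands: the point `d⁻¹ • y` lies in the orbit of `y` under the
generators `a`, `b`, `c`. -/
theorem smul_eq_of_fullTwist {a b c d : G} {p : α} (hcd : c * d * c = d * c * d)
    (had : a * d = d * a) (hac : a * c = c * a) (hbd : b * d = d * b) (h3 : c ^ 3 • y = y)
    (h : (d * c * d⁻¹) • y = y)
    (hz : d • c • b • a • a • b • c • d • y = c • c • a • a • y)
    (hp : b • a • a • b • c • c • y = a • a • p) : d • p = y := by
  have cd (x : α) : c • d • c • x = d • c • d • x := by simp only [← mul_smul, ← mul_assoc, hcd]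
  have ad (x : α) : a • d • x = d • a • x := by rw [← mul_smul, had, mul_smul]
  have ac (x : α) : a • c • x = c • a • x := by rw [← mul_smul, hac, mul_smul]
  have bd (x : α) : b • d • x = d • b • x := by rw [← mul_smul, hbd, mul_smul]
  have h3 : c • c • c • y = y := by simpa [pow_three, mul_smul] using h3
  obtain ⟨q, rfl⟩ : ∃ q, y = d • q := ⟨d⁻¹ • y, (smul_inv_smul d y).symm⟩
  have hq : c • q = q := by simpa [mul_smul] using h
  have hdc : d • c • d • q = c • d • q := by rw [← cd, hq]
  obtain ⟨v, hv⟩ : ∃ v, d • q = c • d • c • v :=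
    ⟨c⁻¹ • d⁻¹ • c⁻¹ • d • q, by simp⟩
  have hqv : q = d • v := by
    rw [cd, smul_left_cancel_iff] at hv
    rw [← hq] at hv
    exact smul_left_cancel c (by rw [hv])
  have h1 : c • b • a • a • b • c • d • d • q = a • a • c • v := by
    have h4 : c • c • d • q = d • c • v := smul_left_cancel c (h3.trans hv)
    apply smul_left_cancel d
    rw [hz, ← ad, ← ad, ← h4]
    simp only [ac]
  have h2 : a • a • q = b • a • a • b • c • c • d • q := by
    rw [ac, ac, smul_left_cancel_iff] at h1
    rw [hqv, ad, ad, ← h1, ← hqv]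
    rw [← bd, ← ad, ← ad, ← bd, ← cd, hdc]
  rw [hp, smul_left_cancel_iff, smul_left_cancel_iff] at h2
  rw [h2]

/-- On five strands, the entry that depends on the full twist. -/
theorem realised_twentyfive_three
    (hr : ∀ k i, k < 27 → i < 3 → Realised s y k i)
    (hbraid : s 2 * s 3 * s 2 = s 3 * s 2 * s 3)
    (h03 : s 0 * s 3 = s 3 * s 0) (h02 : s 0 * s 2 = s 2 * s 0) (h13 : s 1 * s 3 = s 3 * s 1)
    (h3 : s 2 ^ 3 • y = y) (h : (s 3 * s 2 * (s 3)⁻¹) • y = y)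
    (hz : ((s 0 * s 1 * s 2) ^ 4 * (s 3 * s 2 * s 1 * s 0 * s 0 * s 1 * s 2 * s 3)) • y = y) :
    Realised s y 25 3 := by
  have step (k i : ℕ) (hk : k < 27) (hi : i < 3) :
      s i • cosetRep s k • y = cosetRep s (cosetStep i k) • y := hr k i hk hi
  have r0 : cosetRep s 0 • y = y := by simp [cosetRep, cosetWords]
  have r17 : cosetRep s 17 • y = s 2 • s 2 • s 0 • s 0 • y := by
    simp [cosetRep, cosetWords, mul_smul]
  have t17 : (s 0 * s 1 * s 2) ^ 4 • cosetRep s 17 • y = cosetRep s 0 • y := by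
    simp [pow_succ, mul_smul, step, cosetStep, cosetTable]
  have t22 : s 1 • s 0 • s 0 • s 1 • s 2 • s 2 • cosetRep s 0 • y =
      s 0 • s 0 • cosetRep s 25 • y := by
    simp [step, cosetStep, cosetTable]
  rw [r0] at t17 t22
  rw [Realised, show cosetStep 3 25 = 0 from rfl, r0]
  refine smul_eq_of_fullTwist hbraid h03 h02 h13 h3 h ?_ t22
  rw [← r17, ← smul_left_cancel_iff ((s 0 * s 1 * s 2) ^ 4), t17]
  simpa only [mul_smul] using hz

/-- On six strands, the entry that holds because `s 0 * s 2 * s 4` fixes `y`. -/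
theorem realised_zero_four (h0 : s 0 ^ 3 • y = y) (h2 : s 2 ^ 3 • y = y)
    (h02 : s 0 * s 2 = s 2 * s 0) (h : (s 0 * s 2 * s 4) • y = y) : Realised s y 0 4 := by
  have e : s 4 • y = s 2 • s 2 • s 0 • s 0 • y := by
    rw [← smul_left_cancel_iff (s 0 * s 2), ← mul_smul, h]
    have e0 : s 0 • s 0 • s 0 • y = y := by simpa [pow_three, mul_smul] using h0
    have e2 : s 2 • s 2 • s 2 • y = y := by simpa [pow_three, mul_smul] using h2
    have c02 (x : α) : s 0 • s 2 • x = s 2 • s 0 • x := by rw [← mul_smul, h02, mul_smul]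
    rw [mul_smul, c02, c02, c02, e0, e2]
  simpa [Realised, cosetRep, cosetStep, cosetTable, cosetWords, mul_smul] using e

/-- On six strands, the entry that holds because `s 0 * s 1 * s 3 * s 4` fixes `y`. -/
theorem realised_seventeen_three (h04 : Realised s y 0 4) (h51 : Realised s y 5 1)
    (h20 : Realised s y 2 0) (h : (s 0 * s 1 * s 3 * s 4) • y = y) : Realised s y 17 3 := by
  have r0 : cosetRep s 0 • y = y := by simp [cosetRep, cosetWords]
  rw [Realised, show cosetStep 4 0 = 17 from rfl, r0] at h04
  rw [Realised, show cosetStep 1 5 = 2 from rfl] at h51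
  rw [Realised, show cosetStep 0 2 = 0 from rfl, r0] at h20
  rw [Realised, show cosetStep 3 17 = 5 from rfl, ← smul_left_cancel_iff (s 1), h51,
    ← smul_left_cancel_iff (s 0), h20, ← h04]
  simpa only [mul_smul] using h

end Entries

/-! ### Separating the cosets by tuples of transpositions -/

/-- The three transpositions in the symmetric group on three elements. -/
def transposition (x : ZMod 3) : Equiv.Perm (Fin 3) :=
  if x = 0 then Equiv.swap 0 1 else if x = 1 then Equiv.swap 1 2 else Equiv.swap 0 2

theorem transposition_conj (x y : ZMod 3) :
    transposition x * transposition y * (transposition x)⁻¹ = transposition (2 * x - y) := by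
  revert x y; decide

theorem transposition_injective : Function.Injective transposition := by
  unfold Function.Injective; decide

/-- The elementary Hurwitz move on a list of transpositions. -/
def dihedralMove : ℕ → List (ZMod 3) → List (ZMod 3)
  | 0, x :: y :: l => (2 * x - y) :: x :: l
  | i + 1, x :: l => x :: dihedralMove i l
  | _, l => l

theorem getD_dihedralMove (i : ℕ) (l : List (ZMod 3)) (h : i + 1 < l.length) (k : ℕ) :
    (dihedralMove i l).getD k 0 = if k = i then 2 * l.getD i 0 - l.getD (i + 1) 0
      else if k = i + 1 then l.getD i 0 else l.getD k 0 := by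
  induction i generalizing l k with
  | zero =>
    rcases l with _ | ⟨x, _ | ⟨y, l⟩⟩
    · simp at h
    · simp at h
    · rcases k with _ | _ | k <;> simp [dihedralMove]
  | succ i ih =>
    rcases l with _ | ⟨x, l⟩
    · simp at h
    · have := ih l (by simpa using h)
      rcases k with _ | k
      · simp [dihedralMove]
      · simpa [dihedralMove] using this k

theorem length_dihedralMove (i : ℕ) (l : List (ZMod 3)) : (dihedralMove i l).length = l.length := by
  induction i generalizing l with
  | zero => rcases l with _ | ⟨x, _ | ⟨y, l⟩⟩ <;> rfl
  | succ i ih =>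
    rcases l with _ | ⟨x, l⟩
    · rfl
    · simp [dihedralMove, ih]

/-- The tuple obtained from the alternating one by the `k`-th coset representative. -/
def cosetTuple (k : ℕ) : List (ZMod 3) :=
  (cosetWords.getD k []).foldr dihedralMove [0, 1, 0, 1, 0, 1]

theorem hurwitzAction_cosetRep {n k : ℕ} (hn : n ≤ 6)
    (hk : ∀ a ∈ cosetWords.getD k [], a < n - 1) (i : Fin n) :
    hurwitzAction n _ (cosetRep (sigma n) k) (altCoxeter n) i =
      transposition ((cosetTuple k).getD i 0) := by
  unfold cosetTuple cosetRep
  have key : ∀ w : List ℕ, (∀ a ∈ w, a < n - 1) →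
      (w.foldr dihedralMove [0, 1, 0, 1, 0, 1]).length = 6 ∧
      hurwitzAction n _ ((w.map (sigma n)).prod) (altCoxeter n) =
        fun i : Fin n =>
          transposition ((w.foldr dihedralMove [0, 1, 0, 1, 0, 1]).getD (i : ℕ) 0) := by
    intro w hw
    induction w with
    | nil =>
      refine ⟨rfl, ?_⟩
      funext ⟨i, hi⟩
      have hb : ∀ i < 6, (if Even i then Equiv.swap (0 : Fin 3) 1 else Equiv.swap 1 2) =
          transposition ([0, 1, 0, 1, 0, 1].getD i 0) := by decide
      simpa [altCoxeter, alternating] using hb i (by omega)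
    | cons a w ih =>
      obtain ⟨h1, h2⟩ := ih fun b hb => hw b (by simp [hb])
      have ha : a < n - 1 := hw a (by simp)
      rw [List.map_cons, List.prod_cons, map_mul, Equiv.Perm.mul_apply, h2, List.foldr_cons,
        hurwitzAction_sigma ha]
      refine ⟨by rw [length_dihedralMove, h1], ?_⟩
      funext i
      rw [getD_dihedralMove _ _ (by omega)]
      simp only [hurwitzMove, Equiv.coe_fn_mk, transposition_conj]
      split_ifs <;> rfl
  rw [(key _ hk).2]

theorem lt_of_mem_cosetWords {m N : ℕ} (h : (m, N) ∈ [(1, 3), (2, 8), (3, 27), (4, 40), (5, 40)]) :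
    ∀ k < N, ∀ a ∈ cosetWords.getD k [], a < m := by
  revert m N
  simp only [List.mem_cons, Prod.mk.injEq, List.not_mem_nil, or_false]
  rintro m N (⟨rfl, rfl⟩ | ⟨rfl, rfl⟩ | ⟨rfl, rfl⟩ | ⟨rfl, rfl⟩ | ⟨rfl, rfl⟩) <;> decide +kernel

theorem eq_zero_of_cosetRep_mem {n N k : ℕ}
    (h : (n - 1, N) ∈ [(1, 3), (2, 8), (3, 27)]) (hk : k < N)
    (hmem : cosetRep (sigma n) k ∈ hurwitzStabilizer (altCoxeter n)) : k = 0 := by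
  have h' : n - 1 ≤ 3 := by
    simp only [List.mem_cons, Prod.mk.injEq, List.not_mem_nil, or_false] at h; omega
  have hw := lt_of_mem_cosetWords (m := n - 1) (N := N)
    (List.mem_append_left [(4, 40), (5, 40)] h) k hk
  have hdist : ∀ k < N, (∀ i ≤ n - 1, (cosetTuple k).getD i 0 = (cosetTuple 0).getD i 0) →
      k = 0 := by
    simp only [List.mem_cons, Prod.mk.injEq, List.not_mem_nil, or_false] at h
    generalize n - 1 = m at h
    rcases h with ⟨rfl, rfl⟩ | ⟨rfl, rfl⟩ | ⟨rfl, rfl⟩ <;> decide +kernel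
  refine hdist k hk fun i hi => transposition_injective ?_
  have hi' : i < n := by
    simp only [List.mem_cons, Prod.mk.injEq, List.not_mem_nil, or_false] at h; omega
  rw [← hurwitzAction_cosetRep (by omega) hw ⟨i, hi'⟩,
    ← hurwitzAction_cosetRep (n := n) (k := 0) (by omega) (by simp [cosetWords]) ⟨i, hi'⟩,
    mem_hurwitzStabilizer.mp hmem]
  simp [cosetRep, cosetWords]

/-- On five or six strands the nontrivial coset representatives do not take the alternating tuple
to an alternating tuple. -/
theorem eq_zero_of_cosetRep_alternating {n k : ℕ} (hn : n = 5 ∨ n = 6) (hk : k < 40)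
    {x y : Equiv.Perm (Fin 3)}
    (h : hurwitzAction n _ (cosetRep (sigma n) k) (altCoxeter n) = alternating n x y) : k = 0 := by
  have hw : ∀ a ∈ cosetWords.getD k [], a < n - 1 := by
    rcases hn with rfl | rfl
    · exact lt_of_mem_cosetWords (by simp) k hk
    · exact lt_of_mem_cosetWords (by simp) k hk
  have e (i : Fin n) := (hurwitzAction_cosetRep (by omega) hw i).symm.trans (congrFun h i)
  have hdist : ∀ k < 40, (cosetTuple k).getD 0 0 = (cosetTuple k).getD 2 0 →
      (cosetTuple k).getD 2 0 = (cosetTuple k).getD 4 0 →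
      (cosetTuple k).getD 1 0 = (cosetTuple k).getD 3 0 → k = 0 := by decide +kernel
  refine hdist k hk (transposition_injective ?_) (transposition_injective ?_)
    (transposition_injective ?_)
  · have h0 := e ⟨0, by omega⟩
    have h2 := e ⟨2, by omega⟩
    rw [alternating, if_pos (show Even 0 by decide)] at h0
    rw [alternating, if_pos (show Even 2 by decide)] at h2
    exact h0.trans h2.symm
  · have h2 := e ⟨2, by omega⟩
    have h4 := e ⟨4, by omega⟩
    rw [alternating, if_pos (show Even 2 by decide)] at h2
    rw [alternating, if_pos (show Even 4 by decide)] at h4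
    exact h2.trans h4.symm
  · have h1 := e ⟨1, by omega⟩
    have h3 := e ⟨3, by omega⟩
    rw [alternating, if_neg (show ¬Even 1 by decide)] at h1
    rw [alternating, if_neg (show ¬Even 3 by decide)] at h3
    exact h1.trans h3.symm

/-! ### At most four strands -/

theorem smul_one_quotient {G : Type*} [Group G] {H : Subgroup G} {e : G} (he : e ∈ H) :
    e • ((1 : G) : G ⧸ H) = ((1 : G) : G ⧸ H) := by
  rw [MulAction.Quotient.smul_coe, QuotientGroup.eq]
  simpa using he

/-- The table entries from which the coset enumeration starts on at least four strands. -/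
theorem realised_start {n : ℕ} {H : Subgroup (BraidGroup n)} (hH : bandSubgroup (altMatrix n) ≤ H)
    (hn : 4 ≤ n) :
    ∀ p ∈ [(2, 0), (6, 1), (6, 0), (14, 2), (14, 1)],
      p.2 < 5 ∧ Realised (sigma n) ((1 : BraidGroup n) : BraidGroup n ⧸ H) p.1 p.2 := by
  have h0 := smul_one_quotient (hH (sigma_pow_three_mem_bandSubgroup (n := n) (k := 0) (by omega)))
  have h1 := smul_one_quotient (hH (sigma_pow_three_mem_bandSubgroup (n := n) (k := 1) (by omega)))
  have h2 := smul_one_quotient (hH (sigma_pow_three_mem_bandSubgroup (n := n) (k := 2) (by omega)))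
  have h4 := smul_one_quotient (hH (skipTwist_mem_bandSubgroup (n := n) (k := 0) (by omega)))
  have h5 := smul_one_quotient (hH (skipTwist_mem_bandSubgroup (n := n) (k := 1) (by omega)))
  simp only [List.mem_cons, List.not_mem_nil, or_false]
  rintro p (rfl | rfl | rfl | rfl | rfl)
  exacts [⟨by simp, realised_two_zero h0⟩, ⟨by simp, realised_six_one h1⟩,
    ⟨by simp, realised_six_zero h1 h4⟩, ⟨by simp, realised_fourteen_two h2⟩,
    ⟨by simp, realised_fourteen_one h2 h5⟩]

theorem hurwitzStabilizer_altCoxeter_le {n : ℕ} (hn : 2 ≤ n) (hn' : n ≤ 4) :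
    hurwitzStabilizer (altCoxeter n) ≤ bandSubgroup (altMatrix n) := by
  intro b hb
  have hle := (bandSubgroup_le_hurwitzStabilizer n).trans
    (hurwitzStabilizer_altArtin_le_altCoxeter n)
  have main : ∀ N, (n - 1, N) ∈ [(1, 3), (2, 8), (3, 27)] →
      (∃ k < N, (cosetRep (sigma n) k)⁻¹ * b ∈ bandSubgroup (altMatrix n)) →
      b ∈ bandSubgroup (altMatrix n) := by
    rintro N hN ⟨k, hk, h⟩
    have hr : cosetRep (sigma n) k ∈ hurwitzStabilizer (altCoxeter n) := by
      have := (hurwitzStabilizer (altCoxeter n)).mul_mem hb (Subgroup.inv_mem _ (hle h))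
      simpa using this
    rw [eq_zero_of_cosetRep_mem hN hk hr] at h
    simpa [cosetRep, cosetWords] using h
  have h0 := smul_one_quotient (sigma_pow_three_mem_bandSubgroup (n := n) (k := 0) (by omega))
  rcases (by omega : n = 2 ∨ n = 3 ∨ n = 4) with rfl | rfl | rfl
  · refine main 3 (by simp) (exists_cosetRep_of_completes completes_one (by omega) (by omega) ?_ b)
    simp only [List.mem_cons, List.not_mem_nil, or_false]
    rintro p rfl
    exact ⟨by simp, realised_two_zero h0⟩
  · refine main 8 (by simp) (exists_cosetRep_of_completes completes_two (by omega) (by omega) ?_ b)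
    have h1 := smul_one_quotient (sigma_pow_three_mem_bandSubgroup (n := 3) (k := 1) (by omega))
    have h4 := smul_one_quotient (skipTwist_mem_bandSubgroup (n := 3) (k := 0) (by omega))
    simp only [List.mem_cons, List.not_mem_nil, or_false]
    rintro p (rfl | rfl | rfl)
    exacts [⟨by simp, realised_two_zero h0⟩, ⟨by simp, realised_six_one h1⟩,
      ⟨by simp, realised_six_zero h1 h4⟩]
  · exact main 27 (by simp) (exists_cosetRep_of_completes completes_three (by omega) (by omega)
      (realised_start le_rfl (by omega)) b)

/-! ### Braids acting by conjugation -/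

/-- The braid `b` acts on the tuple `t` as simultaneous conjugation by `c`. -/
def ActsByConj {n : ℕ} {G : Type*} [Group G] (t : Fin n → G) (b : BraidGroup n) (c : G) : Prop :=
  hurwitzAction n G b t = fun i => c * t i * c⁻¹

theorem hurwitzAction_conj {n : ℕ} {G : Type*} [Group G] (t : Fin n → G) (b : BraidGroup n)
    (c : G) : hurwitzAction n G b (fun i => c * t i * c⁻¹) =
      fun i => c * hurwitzAction n G b t i * c⁻¹ :=
  hurwitzAction_comp (MulAut.conj c).toMonoidHom b t

namespace ActsByConj

variable {n : ℕ} {G : Type*} [Group G] {t : Fin n → G} {b b' : BraidGroup n} {c c' : G}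

theorem mul (h : ActsByConj t b c) (h' : ActsByConj t b' c') :
    ActsByConj t (b * b') (c' * c) := by
  unfold ActsByConj at *
  rw [map_mul, Equiv.Perm.mul_apply, h', hurwitzAction_conj, h]
  funext i; group

theorem inv (h : ActsByConj t b c) : ActsByConj t b⁻¹ c⁻¹ := by
  unfold ActsByConj at *
  rw [map_inv, Equiv.Perm.inv_eq_iff_eq, hurwitzAction_conj, h]
  funext i; group

theorem pow (h : ActsByConj t b c) (k : ℕ) : ActsByConj t (b ^ k) (c ^ k) := by
  induction k with
  | zero => simp [ActsByConj]
  | succ k ih => rw [pow_succ, pow_succ']; exact ih.mul h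

theorem zpow (h : ActsByConj t b c) (k : ℤ) : ActsByConj t (b ^ k) (c ^ k) := by
  cases k with
  | ofNat k => simpa using h.pow k
  | negSucc k => simpa using (h.pow (k + 1)).inv

theorem of_mem (h : b ∈ hurwitzStabilizer t) : ActsByConj t b 1 := by
  rw [mem_hurwitzStabilizer] at h
  simp [ActsByConj, h]

theorem mem (h : ActsByConj t b 1) : b ∈ hurwitzStabilizer t := by
  unfold ActsByConj at h
  simp [mem_hurwitzStabilizer, h]

theorem commute (h : ActsByConj t b c) (hb : b ∈ hurwitzStabilizer t) (i : Fin n) :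
    Commute c (t i) := by
  unfold ActsByConj at h
  rw [mem_hurwitzStabilizer.mp hb] at h
  exact (eq_mul_inv_iff_mul_eq.mp (congrFun h i)).symm

theorem map {H : Type*} [Group H] (f : G →* H) (h : ActsByConj t b c) :
    ActsByConj (f ∘ t) b (f c) := by
  unfold ActsByConj at *
  rw [hurwitzAction_comp, h]
  funext i; simp

end ActsByConj

/-- If an element of the stabiliser and the `k`-th coset representative differ by an element acting
by conjugation, then `k = 0`. -/
theorem eq_zero_of_actsByConj {n k : ℕ} (hn : n = 5 ∨ n = 6) (hk : k < 40) {b : BraidGroup n}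
    {c : BraidGroup 3} (hb : b ∈ hurwitzStabilizer (altArtin n))
    (h : ActsByConj (altArtin n) ((cosetRep (sigma n) k)⁻¹ * b) c) : k = 0 := by
  have h1 := ((ActsByConj.of_mem hb).mul h.inv)
  rw [mul_inv_rev, inv_inv, mul_inv_cancel_left, mul_one] at h1
  have h2 := h1.map (braidThreeLift (Equiv.swap 0 1) (Equiv.swap 1 2)
    (by decide : (_ : Equiv.Perm (Fin 3)) = _))
  rw [altArtin, comp_alternating, braidThreeLift_sigma_zero, braidThreeLift_sigma_one] at h2
  exact eq_zero_of_cosetRep_alternating hn hk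
    (h2.trans (comp_alternating (MulAut.conj _).toMonoidHom n _ _))

/-! ### Five strands -/

section FullTwist

variable {G : Type*} [Group G] {a b c d : G}

theorem fullTwist_five_eq (hab : a * b * a = b * a * b) (hbc : b * c * b = c * b * c)
    (hcd : c * d * c = d * c * d) (hac : a * c = c * a) (had : a * d = d * a)
    (hbd : b * d = d * b) :
    (a * b * c * d) ^ 5 = (a * b * c) ^ 4 * (d * c * b * a * a * b * c * d) := by
  have ab (x : G) : b * (a * (b * x)) = a * (b * (a * x)) := by simp only [← mul_assoc, hab]
  have bc (x : G) : c * (b * (c * x)) = b * (c * (b * x)) := by simp only [← mul_assoc, hbc]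
  have cd (x : G) : d * (c * (d * x)) = c * (d * (c * x)) := by simp only [← mul_assoc, hcd]
  have ac (x : G) : c * (a * x) = a * (c * x) := by simp only [← mul_assoc, hac]
  have ad (x : G) : d * (a * x) = a * (d * x) := by simp only [← mul_assoc, had]
  have bd (x : G) : d * (b * x) = b * (d * x) := by simp only [← mul_assoc, hbd]
  -- moving the words `d`, `d * c`, `d * c * b` past `a * b * c * d`
  have e1 (x : G) : d * (a * (b * (c * (d * x)))) = a * (b * (c * (d * (c * x)))) := by
    rw [ad, bd, cd]
  have e2 (x : G) : d * (c * (a * (b * (c * (d * x))))) =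
      a * (b * (c * (d * (c * (b * x))))) := by
    rw [ac, bc, ad, bd, ← bd x, cd]
  have e3 (x : G) : d * (c * (b * (a * (b * (c * (d * x)))))) =
      a * (b * (c * (d * (c * (b * (a * x)))))) := by
    rw [ab, ac, ← ac (d * x), bc, ad, bd, ← ad x, ← bd (a * x), cd]
  have h2 : (a * b * c * d) ^ 2 = (a * b * c) ^ 2 * (d * c) := by
    have := e1 1
    simp only [pow_two, mul_assoc, mul_one] at *
    rw [this]
  have h3 : (a * b * c * d) ^ 3 = (a * b * c) ^ 3 * (d * c * b) := by
    have := e2 1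
    rw [pow_succ, h2, pow_succ _ 2]
    simp only [mul_assoc, mul_one] at *
    rw [this]
  have h4 : (a * b * c * d) ^ 4 = (a * b * c) ^ 4 * (d * c * b * a) := by
    have := e3 1
    rw [pow_succ, h3, pow_succ _ 3]
    simp only [mul_assoc, mul_one] at *
    rw [this]
  rw [pow_succ, h4]
  simp only [mul_assoc]

theorem fullTwist_five_commute (hab : a * b * a = b * a * b) (hbc : b * c * b = c * b * c)
    (hcd : c * d * c = d * c * d) (hac : a * c = c * a) (had : a * d = d * a)
    (hbd : b * d = d * b) :
    Commute ((a * b * c * d) ^ 5) a ∧ Commute ((a * b * c * d) ^ 5) b ∧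
      Commute ((a * b * c * d) ^ 5) c ∧ Commute ((a * b * c * d) ^ 5) d := by
  set δ := a * b * c * d with hδ
  have e1 : SemiconjBy δ a b := by
    unfold SemiconjBy
    calc a * b * c * d * a = a * b * c * (a * d) := by rw [had]; group
      _ = a * b * (a * c) * d := by rw [hac]; group
      _ = (a * b * a) * c * d := by group
      _ = b * (a * b * c * d) := by rw [hab]; group
  have e2 : SemiconjBy δ b c := by
    unfold SemiconjBy
    calc a * b * c * d * b = a * b * c * (b * d) := by rw [hbd]; group
      _ = a * (b * c * b) * d := by group
      _ = (a * c) * b * c * d := by rw [hbc]; group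
      _ = c * (a * b * c * d) := by rw [hac]; group
  have e3 : SemiconjBy δ c d := by
    unfold SemiconjBy
    calc a * b * c * d * c = a * b * (c * d * c) := by group
      _ = a * (b * d) * c * d := by rw [hcd]; group
      _ = (a * d) * b * c * d := by rw [hbd]; group
      _ = d * (a * b * c * d) := by rw [had]; group
  have e4 : SemiconjBy (δ ^ 2) d a := by
    have h := (e1.mul_right e2).mul_right e3
    unfold SemiconjBy at *
    calc δ ^ 2 * d = a * (b * c * d * δ) * d := by rw [pow_two]; nth_rw 1 [hδ]; group
      _ = a * δ * (a * b * c * d) := by rw [← h]; group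
      _ = a * δ ^ 2 := by rw [← hδ, pow_two, mul_assoc]
  have h1 : Commute (δ ^ 5) a := by
    have h := e4.mul_left ((e3.mul_left e2).mul_left e1)
    have e5 : δ ^ 2 * (δ * δ * δ) = δ ^ 5 := by group
    rwa [e5] at h
  have hpow : Commute (δ ^ 5) δ := (Commute.refl δ).pow_left 5
  have next {x y : G} (hx : Commute (δ ^ 5) x) (hxy : SemiconjBy δ x y) : Commute (δ ^ 5) y := by
    have : y = δ * x * δ⁻¹ := eq_mul_inv_of_mul_eq hxy.eq.symm
    rw [this]
    exact (hpow.mul_right hx).mul_right hpow.inv_right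
  exact ⟨h1, next h1 e1, next (next h1 e1) e2, next (next (next h1 e1) e2) e3⟩

end FullTwist

/-- The full twist on five strands. -/
def fullTwistFive : BraidGroup 5 := (sigma 5 0 * sigma 5 1 * sigma 5 2 * sigma 5 3) ^ 5

theorem commute_fullTwistFive (b : BraidGroup 5) : Commute fullTwistFive b := by
  obtain ⟨h0, h1, h2, h3⟩ := fullTwist_five_commute
    (sigma_braid (n := 5) (k := 0) (by omega)) (sigma_braid (n := 5) (k := 1) (by omega))
    (sigma_braid (n := 5) (k := 2) (by omega)) (sigma_comm (n := 5) (i := 0) (j := 2) (by omega)).eq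
    (sigma_comm (n := 5) (i := 0) (j := 3) (by omega)).eq
    (sigma_comm (n := 5) (i := 1) (j := 3) (by omega)).eq
  induction b using BraidGroup.induction with
  | one => exact Commute.one_right _
  | sigma k hk =>
    have hk : k < 4 := hk
    interval_cases k
    exacts [h0, h1, h2, h3]
  | mul a b ha hb => exact ha.mul_right hb
  | inv a ha => exact ha.inv_right

theorem actsByConj_fullTwistFive {G : Type*} [Group G] (t : Fin 5 → G) :
    ActsByConj t fullTwistFive (t 0 * t 1 * t 2 * t 3 * t 4) := by
  have step (g₀ g₁ g₂ g₃ g₄ : G) : hurwitzAction 5 G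
      (sigma 5 0 * sigma 5 1 * sigma 5 2 * sigma 5 3) ![g₀, g₁, g₂, g₃, g₄] =
      ![g₀ * g₁ * g₂ * g₃ * g₄ * (g₀ * g₁ * g₂ * g₃)⁻¹, g₀, g₁, g₂, g₃] := by
    rw [map_mul, map_mul, map_mul, hurwitzAction_sigma (by omega), hurwitzAction_sigma (by omega),
      hurwitzAction_sigma (by omega), hurwitzAction_sigma (by omega)]
    funext i
    fin_cases i <;> simp [hurwitzMove, mul_assoc]
  have ht : t = ![t 0, t 1, t 2, t 3, t 4] := by funext i; fin_cases i <;> rfl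
  unfold ActsByConj
  rw [ht]
  generalize t 0 = g₀, t 1 = g₁, t 2 = g₂, t 3 = g₃, t 4 = g₄
  rw [fullTwistFive, map_pow]
  simp only [pow_succ, pow_zero, one_mul, Equiv.Perm.mul_apply, step]
  funext i
  fin_cases i <;> simp [mul_assoc]

open scoped MatrixGroups

/-- The lower triangular transvection in `SL(2, ℤ)`. -/
def lowerTransvection : SL(2, ℤ) := ⟨!![1, 0; -1, 1], by simp⟩

theorem coe_lowerTransvection :
    (lowerTransvection : Matrix (Fin 2) (Fin 2) ℤ) = !![1, 0; -1, 1] := rfl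

theorem lowerTransvection_braid : lowerTransvection * ModularGroup.T * lowerTransvection =
    ModularGroup.T * lowerTransvection * ModularGroup.T :=
  Subtype.ext (by
    simp [Matrix.SpecialLinearGroup.coe_mul, ModularGroup.coe_T, coe_lowerTransvection])

/-- The standard representation of the braid group on three strands in `SL(2, ℤ)`. -/
def braidThreeRep : BraidGroup 3 →* SL(2, ℤ) :=
  braidThreeLift lowerTransvection ModularGroup.T lowerTransvection_braid

@[simp] theorem coe_braidThreeRep_sigma_zero :
    (braidThreeRep (sigma 3 0) : Matrix (Fin 2) (Fin 2) ℤ) = !![1, 0; -1, 1] := by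
  rw [braidThreeRep, braidThreeLift_sigma_zero, coe_lowerTransvection]

@[simp] theorem coe_braidThreeRep_sigma_one :
    (braidThreeRep (sigma 3 1) : Matrix (Fin 2) (Fin 2) ℤ) = !![1, 1; 0, 1] := by
  rw [braidThreeRep, braidThreeLift_sigma_one, ModularGroup.coe_T]

theorem altArtin_of_even {n : ℕ} {i : Fin n} (h : Even (i : ℕ)) : altArtin n i = sigma 3 0 :=
  if_pos h

theorem altArtin_of_odd {n : ℕ} {i : Fin n} (h : ¬Even (i : ℕ)) : altArtin n i = sigma 3 1 :=
  if_neg h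

/-- No nontrivial power of the full twist on five strands stabilises the alternating Artin
system. -/
theorem fullTwistFive_zpow_mem {k : ℤ} (h : fullTwistFive ^ k ∈ hurwitzStabilizer (altArtin 5)) :
    k = 0 := by
  have h1 := (((actsByConj_fullTwistFive (altArtin 5)).zpow k).commute h 0).map braidThreeRep
  have e0 : altArtin 5 0 = sigma 3 0 := altArtin_of_even (by decide)
  have e1 : altArtin 5 1 = sigma 3 1 := altArtin_of_odd (by decide)
  have e2 : altArtin 5 2 = sigma 3 0 := altArtin_of_even (by decide)
  have e3 : altArtin 5 3 = sigma 3 1 := altArtin_of_odd (by decide)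
  have e4 : altArtin 5 4 = sigma 3 0 := altArtin_of_even (by decide)
  rw [e0, e1, e2, e3, e4, map_zpow] at h1
  -- the product is mapped to minus the inverse of `T`, so that its square is a power of `T`
  have hsq : braidThreeRep (sigma 3 0 * sigma 3 1 * sigma 3 0 * sigma 3 1 * sigma 3 0) *
      braidThreeRep (sigma 3 0 * sigma 3 1 * sigma 3 0 * sigma 3 1 * sigma 3 0) =
      ModularGroup.T ^ (-2 : ℤ) := by
    refine Subtype.ext ?_
    rw [ModularGroup.coe_T_zpow]
    simp [Matrix.SpecialLinearGroup.coe_mul]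
  have h2 := h1.mul_left h1
  rw [← (Commute.refl _).mul_zpow, hsq, ← zpow_mul] at h2
  have h3 := congrArg (fun M : SL(2, ℤ) => (M : Matrix (Fin 2) (Fin 2) ℤ) 0 0) h2.eq
  simp only [Matrix.SpecialLinearGroup.coe_mul, ModularGroup.coe_T_zpow,
    coe_braidThreeRep_sigma_zero] at h3
  simpa using h3

/-- On five strands, the stabiliser is contained in the subgroup generated by the band subgroup and
the full twist; the powers of the full twist are excluded as they act by nontrivial conjugations. -/
theorem hurwitzStabilizer_altArtin_five_le :
    hurwitzStabilizer (altArtin 5) ≤ bandSubgroup (altMatrix 5) := by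
  intro b hb
  let H := bandSubgroup (altMatrix 5) ⊔ Subgroup.zpowers fullTwistFive
  have hEH : bandSubgroup (altMatrix 5) ≤ H := le_sup_left
  have hstart := realised_start (n := 5) hEH (by omega)
  have hbraid (i : ℕ) (hi : i + 1 < 4) := sigma_braid (n := 5) (k := i) (by omega)
  have hcomm (i j : ℕ) (h : i + 2 ≤ j) := (sigma_comm (n := 5) h).eq
  have hz := smul_one_quotient (H := H) (e := fullTwistFive)
    (le_sup_right (a := bandSubgroup (altMatrix 5)) (Subgroup.mem_zpowers _))
  rw [fullTwistFive, fullTwist_five_eq (hbraid 0 (by omega)) (hbraid 1 (by omega))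
    (hbraid 2 (by omega)) (hcomm 0 2 (by omega)) (hcomm 0 3 (by omega)) (hcomm 1 3 (by omega))]
    at hz
  have h25 : Realised (sigma 5) ((1 : BraidGroup 5) : BraidGroup 5 ⧸ H) 25 3 :=
    realised_twentyfive_three
      (fun k i hk hi => (realised_of_completes completes_three (by omega)
        (fun i hi => hbraid i (by omega)) hcomm hstart hk hi).1)
      (hbraid 2 (by omega)) (hcomm 0 3 (by omega)) (hcomm 0 2 (by omega)) (hcomm 1 3 (by omega))
      (smul_one_quotient (hEH (sigma_pow_three_mem_bandSubgroup (by omega))))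
      (smul_one_quotient (hEH (skipTwist_mem_bandSubgroup (k := 2) (by omega)))) hz
  obtain ⟨k, hk, h⟩ := exists_cosetRep_of_completes completes_four (H := H) (by omega) (by omega)
    (fun p hp => by
      rcases List.mem_append.mp (show p ∈ [(2, 0), (6, 1), (6, 0), (14, 2), (14, 1)] ++ [(25, 3)]
        from hp) with hp | hp
      · exact hstart p hp
      · rw [List.mem_singleton] at hp
        subst hp
        exact ⟨by simp, h25⟩) b
  have hnorm : (Subgroup.zpowers fullTwistFive).Normal := ⟨by
    rintro _ ⟨j, rfl⟩ g
    refine ⟨j, ?_⟩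
    simp only
    rw [((commute_fullTwistFive g).zpow_left j).symm.eq, mul_inv_cancel_right]⟩
  obtain ⟨e, he, _, ⟨j, rfl⟩, hej⟩ := Subgroup.mem_sup_of_normal_right.mp h
  have heA := bandSubgroup_le_hurwitzStabilizer 5 he
  have hact := (ActsByConj.of_mem heA).mul ((actsByConj_fullTwistFive (altArtin 5)).zpow j)
  simp only at hej
  rw [hej] at hact
  have h0 := eq_zero_of_actsByConj (Or.inl rfl) hk hb hact
  subst h0
  have hr0 : cosetRep (sigma 5) 0 = 1 := by simp [cosetRep, cosetWords]
  rw [hr0, inv_one, one_mul] at hej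
  have hj : j = 0 := by
    apply fullTwistFive_zpow_mem
    have := (hurwitzStabilizer (altArtin 5)).mul_mem (Subgroup.inv_mem _ heA) hb
    rwa [← hej, inv_mul_cancel_left] at this
  rw [← hej, hj]
  simpa using he

/-- The square of the full twist on the first five strands acts on the alternating tuple as
conjugation by the square of a transposition, but it does not stabilise the Artin system. -/
theorem not_hurwitzStabilizer_altCoxeter_le {n : ℕ} (hn : 5 ≤ n) :
    ¬ hurwitzStabilizer (altCoxeter n) ≤ hurwitzStabilizer (altArtin n) := by
  intro hle
  have h5 : 5 + 0 ≤ n := hn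
  have hC : fullTwistFive ^ (2 : ℤ) ∈ hurwitzStabilizer (altCoxeter 5) := by
    have h := (actsByConj_fullTwistFive (altCoxeter 5)).zpow 2
    have e : (altCoxeter 5 0 * altCoxeter 5 1 * altCoxeter 5 2 * altCoxeter 5 3 *
      altCoxeter 5 4) ^ (2 : ℤ) = 1 := by decide
    rw [e] at h
    exact h.mem
  have h1 : windowHom 0 h5 (fullTwistFive ^ (2 : ℤ)) ∈ hurwitzStabilizer (altCoxeter n) := by
    rw [windowHom_mem_hurwitzStabilizer, altCoxeter, window_alternating_even h5 (by simp)]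
    exact hC
  have h2 := hle h1
  rw [windowHom_mem_hurwitzStabilizer, altArtin, window_alternating_even h5 (by simp)] at h2
  exact absurd (fullTwistFive_zpow_mem h2) (by norm_num)

/-! ### Six strands -/

/-- A braid on six strands acting on the alternating Artin system as conjugation by an element
that is mapped to the matrix `A`. -/
def ActsAs (b : BraidGroup 6) (A : Matrix (Fin 2) (Fin 2) ℤ) : Prop :=
  ∃ c, ActsByConj (altArtin 6) b c ∧ (braidThreeRep c : Matrix (Fin 2) (Fin 2) ℤ) = A

theorem ActsAs.mul {b b' : BraidGroup 6} {A A' : Matrix (Fin 2) (Fin 2) ℤ} (h : ActsAs b A)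
    (h' : ActsAs b' A') : ActsAs (b * b') (A' * A) := by
  obtain ⟨c, hc, rfl⟩ := h
  obtain ⟨c', hc', rfl⟩ := h'
  exact ⟨c' * c, hc.mul hc', by rw [map_mul, Matrix.SpecialLinearGroup.coe_mul]⟩

theorem ActsAs.of_mem {b : BraidGroup 6} (h : b ∈ hurwitzStabilizer (altArtin 6)) : ActsAs b 1 :=
  ⟨1, ActsByConj.of_mem h, by simp⟩

/-- An element commuting with both generators is mapped to a scalar matrix. -/
theorem ActsAs.scalar {b : BraidGroup 6} {A : Matrix (Fin 2) (Fin 2) ℤ} (h : ActsAs b A)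
    (hb : b ∈ hurwitzStabilizer (altArtin 6)) : A 0 1 = 0 ∧ A 1 0 = 0 ∧ A 0 0 = A 1 1 := by
  obtain ⟨c, hc, rfl⟩ := h
  have h0 := (hc.commute hb 0).map braidThreeRep
  have h1 := (hc.commute hb 1).map braidThreeRep
  rw [altArtin_of_even (by decide)] at h0
  rw [altArtin_of_odd (by decide)] at h1
  have h0 := congrArg (fun M : SL(2, ℤ) => (M : Matrix (Fin 2) (Fin 2) ℤ)) h0.eq
  have h1 := congrArg (fun M : SL(2, ℤ) => (M : Matrix (Fin 2) (Fin 2) ℤ)) h1.eq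
  simp only [Matrix.SpecialLinearGroup.coe_mul, coe_braidThreeRep_sigma_zero,
    coe_braidThreeRep_sigma_one] at h0 h1
  have h00 := congrFun (congrFun h0 0) 0
  have h10 := congrFun (congrFun h1 0) 0
  have h11 := congrFun (congrFun h1 0) 1
  simp [Matrix.mul_apply, Fin.sum_univ_two] at h00 h10 h11
  exact ⟨h00, h10, by linarith⟩

/-- A braid acting on the alternating sextuple as an element of order three of the modular
group. -/
def orderThreeBraid : BraidGroup 6 := sigma 6 0 * sigma 6 2 * sigma 6 4

/-- A braid acting on the alternating sextuple as an element of order two of the modular group. -/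
def orderTwoBraid : BraidGroup 6 := sigma 6 0 * sigma 6 1 * sigma 6 3 * sigma 6 4

theorem altArtin_six : altArtin 6 = ![sigma 3 0, sigma 3 1, sigma 3 0, sigma 3 1, sigma 3 0,
    sigma 3 1] := by
  funext i
  fin_cases i <;> first | exact altArtin_of_even (by decide) | exact altArtin_of_odd (by decide)

theorem actsAs_orderThreeBraid : ActsAs orderThreeBraid !![0, 1; -1, -1] := by
  refine ⟨sigma 3 0 * sigma 3 1 * sigma 3 0 * sigma 3 1, ?_, by
    simp [Matrix.SpecialLinearGroup.coe_mul]⟩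
  have hb := sigma_braid (n := 3) (k := 0) (by omega)
  unfold ActsByConj
  rw [altArtin_six, orderThreeBraid, map_mul, map_mul, hurwitzAction_sigma (by omega),
    hurwitzAction_sigma (by omega), hurwitzAction_sigma (by omega)]
  generalize sigma 3 0 = a, sigma 3 (0 + 1) = b at *
  have h1 : a * b * a⁻¹ = a * b * a * b * a * (a * b * a * b)⁻¹ := by
    rw [eq_mul_inv_iff_mul_eq]
    calc a * b * a⁻¹ * (a * b * a * b) = a * b * (b * a * b) := by group
      _ = a * b * a * b * a := by rw [← hb]; group
  have h2 : a = a * b * a * b * b * (a * b * a * b)⁻¹ := by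
    rw [eq_mul_inv_iff_mul_eq]
    calc a * (a * b * a * b) = a * (a * b * a) * b := by group
      _ = a * (b * a * b) * b := by rw [hb]
      _ = a * b * a * b * b := by group
  funext i
  fin_cases i <;> simp [hurwitzMove]
  all_goals first | simpa using h1 | simpa using h2

theorem actsAs_orderTwoBraid : ActsAs orderTwoBraid !![0, 1; -1, 0] := by
  refine ⟨sigma 3 0 * sigma 3 1 * sigma 3 0, ?_, by
    simp [Matrix.SpecialLinearGroup.coe_mul]⟩
  have hb := sigma_braid (n := 3) (k := 0) (by omega)
  unfold ActsByConj
  rw [altArtin_six, orderTwoBraid, map_mul, map_mul, map_mul, hurwitzAction_sigma (by omega),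
    hurwitzAction_sigma (by omega), hurwitzAction_sigma (by omega), hurwitzAction_sigma (by omega)]
  generalize sigma 3 0 = a, sigma 3 (0 + 1) = b at *
  have h1 : a * b * a * (b⁻¹ * a⁻¹) = b := by rw [hb]; group
  have h2 : a * b * a * b * (a⁻¹ * (b⁻¹ * a⁻¹)) = a := by
    rw [show a * b * a * b = a * (b * a * b) by group, ← hb]; group
  have h3 : a * (b * a * b⁻¹) * a⁻¹ = b := by
    rw [mul_inv_eq_iff_eq_mul, ← mul_assoc, ← mul_assoc, hb, mul_inv_cancel_right]
  have h4 : b * (a * b * a⁻¹) * b⁻¹ = a := by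
    rw [mul_inv_eq_iff_eq_mul, ← mul_assoc, ← mul_assoc, ← hb, mul_inv_cancel_right]
  funext i
  fin_cases i <;> simp [hurwitzMove, h1, h2, h3, h4]

theorem conj_mul_of_commute {G : Type*} [Group G] {p c x : G} (h : Commute c x) :
    p * c * x * (p * c)⁻¹ = p * x * p⁻¹ := by
  rw [mul_inv_rev, mul_assoc p c x, h.eq]; group

/-- An element of the stabiliser on six strands that only involves five consecutive strands lies in
the band subgroup. -/
theorem windowHom_five_mem {d : ℕ} (hd : 5 + d ≤ 6) {u : BraidGroup 5}
    (h : windowHom d hd u ∈ hurwitzStabilizer (altArtin 6)) :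
    windowHom d hd u ∈ bandSubgroup (altMatrix 6) := by
  refine windowHom_mem_bandSubgroup hd (by omega) (hurwitzStabilizer_altArtin_five_le ?_)
  rw [windowHom_mem_hurwitzStabilizer, altArtin] at h
  by_cases hp : Even d
  · rwa [window_alternating_even hd hp] at h
  · rwa [window_alternating_odd hd hp, hurwitzStabilizer_alternating_swap] at h

theorem sigma_mem_range_windowHom {d : ℕ} (hd : 5 + d ≤ 6) {k : ℕ} (hk : d ≤ k) (hk' : k < 4 + d) :
    sigma 6 k ∈ (windowHom d hd).range :=
  ⟨sigma 5 (k - d), by rw [windowHom_sigma hd (by omega), Nat.sub_add_cancel hk]⟩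

theorem mem_of_mem_range {d : ℕ} (hd : 5 + d ≤ 6) {g : BraidGroup 6}
    (hg : g ∈ (windowHom d hd).range) (h : g ∈ hurwitzStabilizer (altArtin 6)) :
    g ∈ bandSubgroup (altMatrix 6) := by
  obtain ⟨u, rfl⟩ := hg
  exact windowHom_five_mem hd h

theorem conj_mem_hurwitzStabilizer {n : ℕ} {G : Type*} [Group G] {t : Fin n → G}
    {b e : BraidGroup n} {c : G} (hb : ActsByConj t b c) (he : e ∈ hurwitzStabilizer t) :
    b * e * b⁻¹ ∈ hurwitzStabilizer t := by
  have := (hb.mul (ActsByConj.of_mem he)).mul hb.inv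
  rw [one_mul, inv_mul_cancel] at this
  exact this.mem

theorem ActsAs.conj_mem {b e : BraidGroup 6} {A : Matrix (Fin 2) (Fin 2) ℤ} (hb : ActsAs b A)
    (he : e ∈ bandSubgroup (altMatrix 6)) : b * e * b⁻¹ ∈ hurwitzStabilizer (altArtin 6) := by
  obtain ⟨c, hc, -⟩ := hb
  exact conj_mem_hurwitzStabilizer hc (bandSubgroup_le_hurwitzStabilizer 6 he)

theorem skipTwist_mem_range_windowHom {d : ℕ} (hd : 5 + d ≤ 6) {k : ℕ} (hk : d ≤ k) (hk' : k + 1 < 4 + d) :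
    skipTwist 6 k ∈ (windowHom d hd).range :=
  mul_mem (mul_mem (sigma_mem_range_windowHom hd (by omega) hk') (sigma_mem_range_windowHom hd hk (by omega)))
    (inv_mem (sigma_mem_range_windowHom hd (by omega) hk'))

theorem commute_skipTwist {n j k : ℕ} (h : j + 2 ≤ k ∨ k + 3 ≤ j) :
    Commute (sigma n j) (skipTwist n k) := by
  have h1 : Commute (sigma n j) (sigma n k) := by
    rcases h with h | h
    · exact sigma_comm h
    · exact (sigma_comm (by omega)).symm
  have h2 : Commute (sigma n j) (sigma n (k + 1)) := by
    rcases h with h | h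
    · exact sigma_comm (by omega)
    · exact (sigma_comm (by omega)).symm
  exact (h2.mul_right h1).mul_right h2.inv_right

theorem conj_mem_range {G H : Type*} [Group G] [Group H] {f : G →* H} {p x : H} (hp : p ∈ f.range)
    (hx : x ∈ f.range) : p * x * p⁻¹ ∈ f.range :=
  mul_mem (mul_mem hp hx) (inv_mem hp)

theorem conj_mem_bandSubgroup {n : ℕ} {b e : BraidGroup n}
    (h0 : b * sigma n 0 ^ 3 * b⁻¹ ∈ bandSubgroup (altMatrix n))
    (hk : ∀ k, k + 2 < n → b * skipTwist n k * b⁻¹ ∈ bandSubgroup (altMatrix n))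
    (he : e ∈ bandSubgroup (altMatrix n)) : b * e * b⁻¹ ∈ bandSubgroup (altMatrix n) := by
  have hle : bandSubgroup (altMatrix n) ≤
      (bandSubgroup (altMatrix n)).comap (MulAut.conj b).toMonoidHom :=
    bandSubgroup_altMatrix_le h0 hk
  exact hle he

theorem orderThreeBraid_conj_mem {e : BraidGroup 6} (he : e ∈ bandSubgroup (altMatrix 6)) :
    orderThreeBraid * e * orderThreeBraid⁻¹ ∈ bandSubgroup (altMatrix 6) := by
  have e1 : orderThreeBraid = sigma 6 2 * sigma 6 4 * sigma 6 0 := by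
    rw [← ((sigma_comm (n := 6) (i := 0) (j := 2) (by omega)).mul_right
      (sigma_comm (n := 6) (i := 0) (j := 4) (by omega))).eq, orderThreeBraid, mul_assoc]
  refine conj_mem_bandSubgroup ?_ ?_ he
  · have h := actsAs_orderThreeBraid.conj_mem
      (sigma_pow_three_mem_bandSubgroup (n := 6) (k := 0) (by omega))
    refine mem_of_mem_range (d := 0) (by omega) ?_ h
    rw [orderThreeBraid, conj_mul_of_commute
      ((sigma_comm (n := 6) (i := 0) (j := 4) (by omega)).symm.pow_right 3)]
    exact conj_mem_range (mul_mem (sigma_mem_range_windowHom _ (by omega) (by omega))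
      (sigma_mem_range_windowHom _ (by omega) (by omega)))
      (pow_mem (sigma_mem_range_windowHom _ (by omega) (by omega)) 3)
  · intro k hk
    have h := actsAs_orderThreeBraid.conj_mem (skipTwist_mem_bandSubgroup hk)
    by_cases hk2 : k < 2
    · refine mem_of_mem_range (d := 0) (by omega) ?_ h
      rw [orderThreeBraid, conj_mul_of_commute (commute_skipTwist (j := 4) (k := k) (by omega))]
      exact conj_mem_range (mul_mem (sigma_mem_range_windowHom _ (by omega) (by omega))
        (sigma_mem_range_windowHom _ (by omega) (by omega)))
        (skipTwist_mem_range_windowHom _ (by omega) (by omega))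
    · refine mem_of_mem_range (d := 1) (by omega) ?_ h
      rw [e1, conj_mul_of_commute (commute_skipTwist (j := 0) (k := k) (by omega))]
      exact conj_mem_range (mul_mem (sigma_mem_range_windowHom _ (by omega) (by omega))
        (sigma_mem_range_windowHom _ (by omega) (by omega)))
        (skipTwist_mem_range_windowHom _ (by omega) (by omega))

/-- The braid exchanges the two alternating triples. -/
theorem sq_mem_bandSubgroup_three :
    (sigma 3 0 * sigma 3 1) ^ 2 ∈ bandSubgroup (altMatrix 3) := by
  apply hurwitzStabilizer_altCoxeter_le (by omega) (by omega)
  rw [mem_hurwitzStabilizer, map_pow, map_mul, hurwitzAction_sigma (by omega),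
    hurwitzAction_sigma (by omega)]
  decide

theorem sq_mem_bandSubgroup_six {d : ℕ} (hd : 3 + d ≤ 6) :
    (sigma 6 d * sigma 6 (d + 1)) ^ 2 ∈ bandSubgroup (altMatrix 6) := by
  have := windowHom_mem_bandSubgroup hd (by omega) sq_mem_bandSubgroup_three
  rwa [map_pow, map_mul, windowHom_sigma hd (by omega), windowHom_sigma hd (by omega), zero_add,
    add_comm 1 d] at this

theorem orderTwoBraid_sq_mem : orderTwoBraid ^ 2 ∈ bandSubgroup (altMatrix 6) := by
  have hc : Commute (sigma 6 0 * sigma 6 1) (sigma 6 3 * sigma 6 4) :=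
    ((sigma_comm (by omega)).mul_right (sigma_comm (by omega))).mul_left
      ((sigma_comm (by omega)).mul_right (sigma_comm (by omega)))
  rw [orderTwoBraid, mul_assoc (_ * _), hc.mul_pow]
  exact mul_mem (sq_mem_bandSubgroup_six (d := 0) (by omega))
    (sq_mem_bandSubgroup_six (d := 3) (by omega))

theorem orderThreeBraid_cube_mem : orderThreeBraid ^ 3 ∈ bandSubgroup (altMatrix 6) := by
  have h1 : Commute (sigma 6 0 * sigma 6 2) (sigma 6 4) :=
    (sigma_comm (by omega)).mul_left (sigma_comm (by omega))
  have h2 : Commute (sigma 6 0) (sigma 6 2) := sigma_comm (by omega)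
  rw [orderThreeBraid, h1.mul_pow, h2.mul_pow]
  exact mul_mem (mul_mem (sigma_pow_three_mem_bandSubgroup (by omega))
    (sigma_pow_three_mem_bandSubgroup (by omega))) (sigma_pow_three_mem_bandSubgroup (by omega))

theorem orderTwoBraid_conj_mem {e : BraidGroup 6} (he : e ∈ bandSubgroup (altMatrix 6)) :
    orderTwoBraid * e * orderTwoBraid⁻¹ ∈ bandSubgroup (altMatrix 6) := by
  have hc : Commute (sigma 6 0 * sigma 6 1) (sigma 6 3 * sigma 6 4) :=
    ((sigma_comm (by omega)).mul_right (sigma_comm (by omega))).mul_left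
      ((sigma_comm (by omega)).mul_right (sigma_comm (by omega)))
  have e1 : orderTwoBraid = sigma 6 3 * sigma 6 4 * (sigma 6 0 * sigma 6 1) := by
    rw [← hc.eq, orderTwoBraid]; group
  have hfive : sigma 6 0 * sigma 6 1 * sigma 6 3 ∈ (windowHom (m := 5) (n := 6) 0 (by omega)).range :=
    mul_mem (mul_mem (sigma_mem_range_windowHom _ (by omega) (by omega))
      (sigma_mem_range_windowHom _ (by omega) (by omega)))
      (sigma_mem_range_windowHom _ (by omega) (by omega))
  refine conj_mem_bandSubgroup ?_ ?_ he
  · have h := actsAs_orderTwoBraid.conj_mem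
      (sigma_pow_three_mem_bandSubgroup (n := 6) (k := 0) (by omega))
    refine mem_of_mem_range (d := 0) (by omega) ?_ h
    rw [orderTwoBraid, conj_mul_of_commute
      ((sigma_comm (n := 6) (i := 0) (j := 4) (by omega)).symm.pow_right 3)]
    exact conj_mem_range hfive (pow_mem (sigma_mem_range_windowHom _ (by omega) (by omega)) 3)
  · intro k hk
    have h := actsAs_orderTwoBraid.conj_mem (skipTwist_mem_bandSubgroup hk)
    rcases (by omega : k < 2 ∨ k = 2 ∨ k = 3) with hk2 | rfl | rfl
    · refine mem_of_mem_range (d := 0) (by omega) ?_ h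
      rw [orderTwoBraid, conj_mul_of_commute (commute_skipTwist (j := 4) (k := k) (by omega))]
      exact conj_mem_range hfive (skipTwist_mem_range_windowHom _ (by omega) (by omega))
    · -- modulo the band subgroup the first two factors may be inverted, after which the first
      -- generator acts first and commutes with the half twist
      have hsq := sq_mem_bandSubgroup_six (d := 0) (by omega)
      set q := (sigma 6 0 * sigma 6 (0 + 1)) ^ 2 with hq
      set w := (sigma 6 1)⁻¹ * (sigma 6 3 * sigma 6 4) * (sigma 6 0)⁻¹ with hw
      have e2 : orderTwoBraid = q * w := by
        have h04 : Commute (sigma 6 0) (sigma 6 3 * sigma 6 4) :=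
          (sigma_comm (by omega)).mul_right (sigma_comm (by omega))
        rw [hq, hw, mul_assoc _ _ (sigma 6 0)⁻¹, ← h04.inv_left.eq, orderTwoBraid, pow_two, zero_add]
        group
      have hmem : w * skipTwist 6 2 * w⁻¹ ∈ bandSubgroup (altMatrix 6) := by
        refine mem_of_mem_range (d := 1) (by omega) ?_ ?_
        · rw [hw, conj_mul_of_commute (commute_skipTwist (by omega)).inv_left]
          exact conj_mem_range (mul_mem (inv_mem (sigma_mem_range_windowHom _ (by omega) (by omega)))
            (mul_mem (sigma_mem_range_windowHom _ (by omega) (by omega))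
            (sigma_mem_range_windowHom _ (by omega) (by omega))))
            (skipTwist_mem_range_windowHom _ (by omega) (by omega))
        · have hq' := bandSubgroup_le_hurwitzStabilizer 6 hsq
          have := mul_mem (mul_mem (inv_mem hq') h) hq'
          rw [e2] at this
          convert this using 1
          group
      have := mul_mem (mul_mem hsq hmem) (inv_mem hsq)
      rw [e2]
      convert this using 1
      group
    · refine mem_of_mem_range (d := 1) (by omega) ?_ h
      rw [e1, conj_mul_of_commute ((commute_skipTwist (j := 0) (k := 3) (by omega)).mul_left
        (commute_skipTwist (j := 1) (k := 3) (by omega)))]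
      exact conj_mem_range (mul_mem (sigma_mem_range_windowHom _ (by omega) (by omega))
        (sigma_mem_range_windowHom _ (by omega) (by omega)))
        (skipTwist_mem_range_windowHom _ (by omega) (by omega))

/-! ### Faithfulness of the action through the modular group -/

section NormalForm

variable {G : Type*} [Group G] {E : Subgroup G} {y w : G}

/-- `p` has the normal form of the elements of the modular group, that is, of the free product of a
group of order three and one of order two, modulo the subgroup `E`, in
the generators `y` of order three and `w` of order two. -/
def HasNormalForm (E : Subgroup G) (y w p : G) : Prop :=
  ∃ e ∈ E, ∃ α ∈ ({1, w} : Set G), ∃ m ∈ Submonoid.closure {y * w, y * y * w},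
    ∃ β ∈ ({1, y, y * y} : Set G), p = e * (α * m * β)

theorem eq_one_or_of_mem_closure_pair {u v m : G} (hm : m ∈ Submonoid.closure {u, v}) :
    m = 1 ∨ ∃ m' ∈ Submonoid.closure {u, v}, m = m' * u ∨ m = m' * v := by
  induction hm using Submonoid.closure_induction_right with
  | one => exact Or.inl rfl
  | mul_right x hx z hz _ =>
    rcases hz with rfl | rfl
    · exact Or.inr ⟨x, hx, Or.inl rfl⟩
    · exact Or.inr ⟨x, hx, Or.inr rfl⟩

theorem hasNormalForm_of_mem (hy : ∀ e ∈ E, y * e * y⁻¹ ∈ E) (hw : ∀ e ∈ E, w * e * w⁻¹ ∈ E)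
    (hy3 : y ^ 3 ∈ E) (hw2 : w ^ 2 ∈ E) {p : G} (hp : p ∈ Subgroup.closure ((E : Set G) ∪ {y, w})) :
    HasNormalForm E y w p := by
  -- the elements that conjugate `E` into itself
  let N : Submonoid G :=
    { carrier := {g | ∀ e ∈ E, g * e * g⁻¹ ∈ E}
      one_mem' := by simp
      mul_mem' := fun {a b} ha hb e he => by
        have := ha _ (hb e he)
        rwa [show a * (b * e * b⁻¹) * a⁻¹ = a * b * e * (a * b)⁻¹ by group] at this }
  have hyN : y ∈ N := hy
  have hwN : w ∈ N := hw
  have hmN {m : G} (hm : m ∈ Submonoid.closure {y * w, y * y * w}) : m ∈ N := by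
    refine (Submonoid.closure_le.mpr ?_) hm
    rintro x (rfl | rfl)
    exacts [N.mul_mem hyN hwN, N.mul_mem (N.mul_mem hyN hyN) hwN]
  have mulE {p e : G} (hp : HasNormalForm E y w p) (he : e ∈ E) : HasNormalForm E y w (p * e) := by
    obtain ⟨e', he', α, hα, m, hm, β, hβ, rfl⟩ := hp
    have hαN : α ∈ N := by rcases hα with rfl | rfl; exacts [N.one_mem, hwN]
    have hβN : β ∈ N := by
      rcases hβ with rfl | rfl | rfl
      exacts [N.one_mem, hyN, N.mul_mem hyN hyN]
    refine ⟨_, E.mul_mem he' (N.mul_mem (N.mul_mem hαN (hmN hm)) hβN e he), α, hα, m, hm, β, hβ, ?_⟩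
    group
  have mulY {p : G} (hp : HasNormalForm E y w p) : HasNormalForm E y w (p * y) := by
    obtain ⟨e, he, α, hα, m, hm, β, hβ, rfl⟩ := hp
    rcases hβ with rfl | rfl | rfl
    · exact ⟨e, he, α, hα, m, hm, y, by simp, by group⟩
    · exact ⟨e, he, α, hα, m, hm, β * β, by simp, by group⟩
    · have h : HasNormalForm E y w (e * (α * m * 1)) := ⟨e, he, α, hα, m, hm, 1, by simp, rfl⟩
      have := mulE h hy3
      rwa [show e * (α * m * 1) * y ^ 3 = e * (α * m * (y * y)) * y by
        rw [pow_three]; group] at this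
  have mulW {p : G} (hp : HasNormalForm E y w p) : HasNormalForm E y w (p * w) := by
    obtain ⟨e, he, α, hα, m, hm, β, hβ, rfl⟩ := hp
    rcases hβ with rfl | rfl | rfl
    · rcases eq_one_or_of_mem_closure_pair hm with rfl | ⟨m', hm', rfl | rfl⟩
      · rcases hα with rfl | rfl
        · exact ⟨e, he, w, by simp, 1, Submonoid.one_mem _, 1, by simp, by group⟩
        · have h : HasNormalForm E y α (e * (1 * 1 * 1)) :=
            ⟨e, he, 1, by simp, 1, Submonoid.one_mem _, 1, by simp, rfl⟩
          have := mulE h hw2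
          rwa [show e * (1 * 1 * 1) * α ^ 2 = e * (α * 1 * 1) * α by rw [pow_two]; group] at this
      · have h : HasNormalForm E y w (e * (α * m' * y)) :=
          ⟨e, he, α, hα, m', hm', y, by simp, rfl⟩
        have := mulE h hw2
        rwa [show e * (α * m' * y) * w ^ 2 = e * (α * (m' * (y * w)) * 1) * w by
          rw [pow_two]; group] at this
      · have h : HasNormalForm E y w (e * (α * m' * (y * y))) :=
          ⟨e, he, α, hα, m', hm', y * y, by simp, rfl⟩
        have := mulE h hw2
        rwa [show e * (α * m' * (y * y)) * w ^ 2 = e * (α * (m' * (y * y * w)) * 1) * w by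
          rw [pow_two]; group] at this
    · exact ⟨e, he, α, hα, m * (β * w), Submonoid.mul_mem _ hm (Submonoid.subset_closure (by simp)),
        1, by simp, by group⟩
    · exact ⟨e, he, α, hα, m * (y * y * w),
        Submonoid.mul_mem _ hm (Submonoid.subset_closure (by simp)), 1, by simp, by group⟩
  induction hp using Subgroup.closure_induction_right with
  | one => exact ⟨1, E.one_mem, 1, by simp, 1, Submonoid.one_mem _, 1, by simp, by simp⟩
  | mul_right x _ z hz ih =>
    rcases hz with hz | rfl | rfl
    exacts [mulE ih hz, mulY ih, mulW ih]
  | mul_inv_cancel x _ z hz ih =>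
    rcases hz with hz | rfl | rfl
    · exact mulE ih (E.inv_mem hz)
    · have := mulE (mulY (mulY ih)) (E.inv_mem hy3)
      rwa [show x * z * z * (z ^ 3)⁻¹ = x * z⁻¹ by rw [pow_three]; group] at this
    · have := mulE (mulW ih) (E.inv_mem hw2)
      rwa [show x * z * (z ^ 2)⁻¹ = x * z⁻¹ by rw [pow_two]; group] at this

end NormalForm

/-- Up to sign, the matrix has positive diagonal and nonnegative entries, and it is not diagonal. -/
def IsPositive (A : Matrix (Fin 2) (Fin 2) ℤ) : Prop :=
  ∃ p q r s : ℤ, 1 ≤ p ∧ 0 ≤ q ∧ 0 ≤ r ∧ 1 ≤ s ∧ 1 ≤ q + r ∧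
    (A = !![p, q; r, s] ∨ A = !![-p, -q; -r, -s])

/-- The nontrivial products of the braids acting as the two positive transvections act as positive
matrices. -/
theorem eq_one_or_isPositive {m : BraidGroup 6} (hm : m ∈ Submonoid.closure
    {orderThreeBraid * orderTwoBraid, orderThreeBraid * orderThreeBraid * orderTwoBraid}) :
    m = 1 ∨ ∃ A, ActsAs m A ∧ IsPositive A := by
  have hL := actsAs_orderThreeBraid.mul actsAs_orderTwoBraid
  have hR := (actsAs_orderThreeBraid.mul actsAs_orderThreeBraid).mul actsAs_orderTwoBraid
  have eL : (!![0, 1; -1, 0] * !![0, 1; -1, -1] : Matrix (Fin 2) (Fin 2) ℤ) =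
      !![-1, -1; 0, -1] := by simp
  have eR : (!![0, 1; -1, 0] * (!![0, 1; -1, -1] * !![0, 1; -1, -1]) :
      Matrix (Fin 2) (Fin 2) ℤ) = !![1, 0; 1, 1] := by simp
  rw [eL] at hL
  rw [eR] at hR
  induction hm using Submonoid.closure_induction_right with
  | one => exact Or.inl rfl
  | mul_right x _ z hz ih =>
    refine Or.inr ?_
    rcases ih with rfl | ⟨A, hA, p, q, r, s, hp, hq, hr, hs, hqr, h⟩
    · rw [one_mul]
      rcases hz with rfl | rfl
      · exact ⟨_, hL, 1, 1, 0, 1, by simp⟩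
      · exact ⟨_, hR, 1, 0, 1, 1, by simp⟩
    · rcases hz with rfl | rfl
      · refine ⟨_, hA.mul hL, p + r, q + s, r, s, by omega, by omega, hr, hs, by omega, ?_⟩
        rcases h with rfl | rfl
        · right; simp [add_comm]
        · left; simp
      · refine ⟨_, hA.mul hR, p, q, p + r, q + s, hp, hq, by omega, by omega, by omega, ?_⟩
        rcases h with rfl | rfl
        · left; simp
        · right; simp [add_comm]

/-- The modular group acts faithfully: an element of the subgroup generated by the band subgroup and
the two braids of finite order that stabilises the alternating Artin system lies in the band
subgroup. -/
theorem mem_bandSubgroup_of_mem_closure {p : BraidGroup 6}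
    (hp : p ∈ Subgroup.closure ((bandSubgroup (altMatrix 6) : Set (BraidGroup 6)) ∪
      {orderThreeBraid, orderTwoBraid})) (hA : p ∈ hurwitzStabilizer (altArtin 6)) :
    p ∈ bandSubgroup (altMatrix 6) := by
  obtain ⟨e, he, α, hα, m, hm, β, hβ, rfl⟩ := hasNormalForm_of_mem
    (fun _ => orderThreeBraid_conj_mem) (fun _ => orderTwoBraid_conj_mem)
    orderThreeBraid_cube_mem orderTwoBraid_sq_mem hp
  have hg : α * m * β ∈ hurwitzStabilizer (altArtin 6) :=
    (Subgroup.mul_mem_cancel_left _ (bandSubgroup_le_hurwitzStabilizer 6 he)).mp hA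
  suffices h : α * m * β = 1 by rw [h, mul_one]; exact he
  have hact1 := ActsAs.of_mem (one_mem (hurwitzStabilizer (altArtin 6)))
  have hY := actsAs_orderThreeBraid
  have hW := actsAs_orderTwoBraid
  -- the matrix of `α * m * β` is not scalar unless all three factors are trivial
  rcases eq_one_or_isPositive hm with rfl | ⟨A, hA', p, q, r, s, hp, hq, hr, hs, hqr, rfl | rfl⟩
  · rcases hα with rfl | rfl <;> rcases hβ with rfl | rfl | rfl
    · simp
    · have := ((hact1.mul hact1).mul hY).scalar hg
      simp at this
    · have := ((hact1.mul hact1).mul (hY.mul hY)).scalar hg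
      simp at this
    · have := ((hW.mul hact1).mul hact1).scalar hg
      simp at this
    · have := ((hW.mul hact1).mul hY).scalar hg
      simp at this
    · have := ((hW.mul hact1).mul (hY.mul hY)).scalar hg
      simp at this
  all_goals
    exfalso
    rcases hα with rfl | rfl <;> rcases hβ with rfl | rfl | rfl
    · have := ((hact1.mul hA').mul hact1).scalar hg
      simp at this
      omega
    · have := ((hact1.mul hA').mul hY).scalar hg
      simp at this
      omega
    · have := ((hact1.mul hA').mul (hY.mul hY)).scalar hg
      simp at this
      omega
    · have := ((hW.mul hA').mul hact1).scalar hg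
      simp at this
      omega
    · have := ((hW.mul hA').mul hY).scalar hg
      simp at this
      omega
    · have := ((hW.mul hA').mul (hY.mul hY)).scalar hg
      simp at this
      omega

/-- The coset enumeration shows that the stabiliser is contained in the subgroup on which the action
through the modular group is faithful. -/
theorem hurwitzStabilizer_altArtin_six_le :
    hurwitzStabilizer (altArtin 6) ≤ bandSubgroup (altMatrix 6) := by
  intro b hb
  let H := Subgroup.closure ((bandSubgroup (altMatrix 6) : Set (BraidGroup 6)) ∪
    {orderThreeBraid, orderTwoBraid})
  have hEH : bandSubgroup (altMatrix 6) ≤ H :=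
    fun x hx => Subgroup.subset_closure (Or.inl hx)
  have hstart := realised_start (n := 6) hEH (by omega)
  have hr (k i : ℕ) (hk : k < 27) (hi : i < 3) :=
    (realised_of_completes completes_three (by omega)
      (fun i hi => sigma_braid (n := 6) (k := i) (by omega))
      (fun i j h => (sigma_comm (n := 6) h).eq) hstart hk hi).1
  have h04 : Realised (sigma 6) ((1 : BraidGroup 6) : BraidGroup 6 ⧸ H) 0 4 :=
    realised_zero_four (smul_one_quotient (hEH (sigma_pow_three_mem_bandSubgroup (by omega))))
      (smul_one_quotient (hEH (sigma_pow_three_mem_bandSubgroup (by omega))))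
      (sigma_comm (by omega)).eq
      (smul_one_quotient (e := orderThreeBraid) (Subgroup.subset_closure (by simp)))
  have h17 : Realised (sigma 6) ((1 : BraidGroup 6) : BraidGroup 6 ⧸ H) 17 3 :=
    realised_seventeen_three h04 (hr 5 1 (by omega) (by omega)) (hr 2 0 (by omega) (by omega))
      (smul_one_quotient (e := orderTwoBraid) (Subgroup.subset_closure (by simp)))
  obtain ⟨k, hk, h⟩ := exists_cosetRep_of_completes completes_five (H := H) (by omega) (by omega)
    (fun p hp => by
      rcases List.mem_append.mp (show p ∈ [(2, 0), (6, 1), (6, 0), (14, 2), (14, 1)] ++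
        [(0, 4), (17, 3)] from hp) with hp | hp
      · exact hstart p hp
      · simp only [List.mem_cons, List.not_mem_nil, or_false] at hp
        rcases hp with rfl | rfl
        exacts [⟨by simp, h04⟩, ⟨by simp, h17⟩]) b
  have hact : ∃ c, ActsByConj (altArtin 6) ((cosetRep (sigma 6) k)⁻¹ * b) c := by
    generalize (cosetRep (sigma 6) k)⁻¹ * b = p at h
    induction h using Subgroup.closure_induction with
    | mem x hx =>
      rcases hx with hx | rfl | rfl
      · exact ⟨1, ActsByConj.of_mem (bandSubgroup_le_hurwitzStabilizer 6 hx)⟩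
      · exact ⟨_, actsAs_orderThreeBraid.choose_spec.1⟩
      · exact ⟨_, actsAs_orderTwoBraid.choose_spec.1⟩
    | one => exact ⟨1, ActsByConj.of_mem (one_mem _)⟩
    | mul x y _ _ hx hy => exact ⟨_, hx.choose_spec.mul hy.choose_spec⟩
    | inv x _ hx => exact ⟨_, hx.choose_spec.inv⟩
  obtain ⟨c, hc⟩ := hact
  obtain rfl := eq_zero_of_actsByConj (Or.inr rfl) hk hb hc
  refine mem_bandSubgroup_of_mem_closure ?_ hb
  have hr0 : cosetRep (sigma 6) 0 = 1 := by simp [cosetRep, cosetWords]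
  rwa [hr0, inv_one, one_mul] at h

theorem mainTheorem1 (n : ℕ) (hn : 2 ≤ n) :
    (hurwitzStabilizer (artinSystem (altMatrix n)) = hurwitzStabilizer (altArtin n) ∧
      hurwitzStabilizer (coxeterSystem (altMatrix n)) = hurwitzStabilizer (altCoxeter n)) ∧
    (n ≤ 4 →
      bandSubgroup (altMatrix n) = hurwitzStabilizer (altArtin n) ∧
        hurwitzStabilizer (altArtin n) = hurwitzStabilizer (altCoxeter n)) ∧
    (n = 5 ∨ n = 6 →
      bandSubgroup (altMatrix n) = hurwitzStabilizer (altArtin n) ∧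
        hurwitzStabilizer (altArtin n) < hurwitzStabilizer (altCoxeter n)) ∧
    (7 ≤ n →
      bandSubgroup (altMatrix n) ≤ hurwitzStabilizer (altArtin n) ∧
        hurwitzStabilizer (altArtin n) < hurwitzStabilizer (altCoxeter n)) := by
  have hE := bandSubgroup_le_hurwitzStabilizer n
  have hAC := hurwitzStabilizer_altArtin_le_altCoxeter n
  refine ⟨⟨hurwitzStabilizer_artinSystem hn, hurwitzStabilizer_coxeterSystem hn⟩,
    fun h => ?_, fun h => ?_, fun h => ?_⟩
  · have hC := hurwitzStabilizer_altCoxeter_le hn h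
    exact ⟨le_antisymm hE (hAC.trans hC), le_antisymm hAC (hC.trans hE)⟩
  · refine ⟨le_antisymm hE ?_, lt_of_le_not_ge hAC (not_hurwitzStabilizer_altCoxeter_le (by omega))⟩
    rcases h with rfl | rfl
    exacts [hurwitzStabilizer_altArtin_five_le, hurwitzStabilizer_altArtin_six_le]
  · exact ⟨hE, lt_of_le_not_ge hAC (not_hurwitzStabilizer_altCoxeter_le (by omega))⟩
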